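/- Let $H\in(\tfrac12,1)$, $T>0$, $U=L^2(0,1)$, and let $A$ be minus the Laplacian on $(0,1)$ with homogeneous Dirichlet boundary conditions, with eigenfunctions $\phi_k(x)=\sqrt2\sin(k\pi x)$ and eigenvalues $\lambda_k=k^2\pi^2$, $k\ge 1$. On a probability space let $w_1,w_2,\dots$ be independent standard real fractional Brownian motions on $[0,T]$ with Hurst parameter $H$, i.e. centered Gaussian processes with continuous paths and covariance $\tfrac12\left(s^{2H}+t^{2H}-|t-s|^{2H}\right)$, and let $B^H(t)=\sum_{k\ge1}w_k(t)\phi_k$ be the corresponding cylindrical fractional Brownian motion (a formal series). For $N\in\mathbb N$ let $P_N$ be the orthogonal projection of $U$ onto $U^N=\mathrm{span}\{\phi_1,\dots,\phi_N\}$, let $A_N=P_NA$, and for $\eta\ge0$ let $$\mathbb O^{N,\eta}_t=\int_0^t e^{-(t-s)(A_N+\eta)}P_N\,dB^H(s)=\sum_{k\ge1}\int_0^t e^{-(t-s)(A_N+\eta)}P_N\phi_k\,dw_k(s),\qquad t\in[0,T],$$ where the series converges in mean square and each integral with respect to $w_k$ is the mean-square limit of the integrals of step functions $\sigma_m$ converging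 to the integrand $g$, in the sense that $\int_0^t\int_0^t\|g(u)-\sigma_m(u)\|\,\|g(v)-\sigma_m(v)\|\,H(2H-1)|u-v|^{2H-2}\,du\,dv\to0$. Then for every $\tilde c>0$ and every $N\in\mathbb N$ there exists $\eta\ge0$ such that the process $\mathbb O^{N,\eta}$ exists as a jointly measurable process $[0,T]\times\Omega\to U$ and every jointly measurable version of it satisfies $$\mathbb E\left[\exp\left(\tilde c\int_0^T\left(\|\mathbb O^{N,\eta}_t\|_{L^\infty(0,1)}^2+1\right)dt\right)\right]<\infty .$$ -/

import Mathlib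

open MeasureTheory ProbabilityTheory Filter Topology
open scoped ENNReal

namespace BurgersFBM

/-! ### The space `U = L²(0,1)` and the negative Dirichlet Laplacian -/

/-- Lebesgue measure on the interval `(0,1)`. -/
noncomputable abbrev leb01 : Measure ℝ := volume.restrict (Set.Ioo (0 : ℝ) 1)

/-- `U = L²(0,1)`. -/
noncomputable abbrev U : Type := Lp ℝ 2 leb01

/-- `f : U` (that is, its representative) is integrable on `(0,1)`. -/
theorem integrable_coe (f : U) : Integrable (f : ℝ → ℝ) leb01 :=
  (Lp.memLp f).integrable (by norm_num)

theorem intervalIntegrable_coe (f : U) {x : ℝ} (hx : x ∈ Set.Icc (0 : ℝ) 1) :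
    IntervalIntegrable (f : ℝ → ℝ) volume 0 x := by
  rw [intervalIntegrable_iff_integrableOn_Ioo_of_le hx.1]
  exact IntegrableOn.mono_set (integrable_coe f) (Set.Ioo_subset_Ioo_right hx.2)

/-- `f = -u''` with Dirichlet boundary conditions: `u` has a representative `v` on `[0,1]` with
`v(0) = v(1) = 0`, which is differentiable with an absolutely continuous derivative `v'` such that
`v'' = -f` almost everywhere. So `u ∈ H²(0,1) ∩ H¹₀(0,1)` and `f = A u`. -/
def IsNegLaplacian (u f : U) : Prop :=
  ∃ v v' : ℝ → ℝ, (u : ℝ → ℝ) =ᵐ[leb01] v ∧ v 0 = 0 ∧ v 1 = 0 ∧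
    (∀ x ∈ Set.Icc (0 : ℝ) 1, HasDerivWithinAt v (v' x) (Set.Icc 0 1) x) ∧
    (∀ x ∈ Set.Icc (0 : ℝ) 1, v' x = v' 0 - ∫ y in (0 : ℝ)..x, f y)

theorem integral_coe_add (f g : U) {x : ℝ} (hx : x ∈ Set.Icc (0 : ℝ) 1) :
    ∫ y in (0 : ℝ)..x, (f + g : U) y = (∫ y in (0 : ℝ)..x, f y) + ∫ y in (0 : ℝ)..x, g y := by
  rw [← intervalIntegral.integral_add (intervalIntegrable_coe f hx) (intervalIntegrable_coe g hx)]
  simp only [intervalIntegral.integral_of_le hx.1, integral_Ioc_eq_integral_Ioo]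
  refine integral_congr_ae ?_
  exact ae_restrict_of_ae_restrict_of_subset (Set.Ioo_subset_Ioo_right hx.2) (Lp.coeFn_add f g)

theorem integral_coe_smul (c : ℝ) (f : U) {x : ℝ} (hx : x ∈ Set.Icc (0 : ℝ) 1) :
    ∫ y in (0 : ℝ)..x, (c • f : U) y = c * ∫ y in (0 : ℝ)..x, f y := by
  rw [← intervalIntegral.integral_const_mul]
  simp only [intervalIntegral.integral_of_le hx.1, integral_Ioc_eq_integral_Ioo]
  refine integral_congr_ae ?_
  exact ae_restrict_of_ae_restrict_of_subset (Set.Ioo_subset_Ioo_right hx.2) (Lp.coeFn_smul c f)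

/-- The graph of `A`, the negative Laplacian with homogeneous Dirichlet boundary conditions. -/
noncomputable def negLaplacianGraph : Submodule ℝ (U × U) where
  carrier := {p | IsNegLaplacian p.1 p.2}
  zero_mem' := by
    refine ⟨0, 0, Lp.coeFn_zero _ _ _, rfl, rfl, fun x _ => hasDerivWithinAt_const _ _ _, ?_⟩
    intro x hx
    have := integral_coe_smul 0 (0 : U) hx
    rw [zero_smul, zero_mul] at this
    change (0 : ℝ) = 0 - ∫ y in (0 : ℝ)..x, (0 : U) y
    rw [this, sub_zero]
  add_mem' := by
    rintro ⟨u₁, f₁⟩ ⟨u₂, f₂⟩ ⟨v₁, d₁, h₁, a₁, b₁, i₁, j₁⟩ ⟨v₂, d₂, h₂, a₂, b₂, i₂, j₂⟩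
    refine ⟨v₁ + v₂, d₁ + d₂, (Lp.coeFn_add _ _).trans (h₁.add h₂),
      by rw [Pi.add_apply, a₁, a₂, add_zero], by rw [Pi.add_apply, b₁, b₂, add_zero],
      fun x hx => (i₁ x hx).add (i₂ x hx), fun x hx => ?_⟩
    have := integral_coe_add f₁ f₂ hx
    simp only [Pi.add_apply, j₁ x hx, j₂ x hx, Prod.mk_add_mk, this]
    ring
  smul_mem' := by
    rintro c ⟨u, f⟩ ⟨v, d, h, a, b, i, j⟩
    refine ⟨c • v, c • d, (Lp.coeFn_smul _ _).trans (h.const_smul c),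
      by rw [Pi.smul_apply, a, smul_zero], by rw [Pi.smul_apply, b, smul_zero],
      fun x hx => (i x hx).const_smul c, fun x hx => ?_⟩
    have := integral_coe_smul c f hx
    simp only [Pi.smul_apply, j x hx, Prod.smul_mk, this, smul_eq_mul]
    ring

/-- `A : dom(A) ⊆ U → U`, minus the Laplacian with homogeneous Dirichlet boundary conditions. -/
noncomputable def negLaplacian : U →ₗ.[ℝ] U := negLaplacianGraph.toLinearPMap

/-- `-u''` is determined by `u`, so the graph above is the graph of an operator. -/
theorem negLaplacianGraph_functional (p : U × U) (hp : p ∈ negLaplacianGraph) (h0 : p.1 = 0) :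
    p.2 = 0 := by
  obtain ⟨u, f⟩ := p
  obtain ⟨v, d, h, a, b, i, j⟩ := hp
  simp only at h0
  subst h0
  simp only at h j ⊢
  have hv : ∀ᵐ x ∂leb01, v x = 0 := by
    filter_upwards [h, Lp.coeFn_zero ℝ 2 leb01] with x h1 h2
    rw [← h1, h2, Pi.zero_apply]
  have hcont : ContinuousOn v (Set.Ioo 0 1) := fun x hx =>
    ((i x (Set.Ioo_subset_Icc_self hx)).continuousWithinAt).mono Set.Ioo_subset_Icc_self
  have hv0 : Set.EqOn v (fun _ => 0) (Set.Ioo 0 1) :=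
    Measure.eqOn_open_of_ae_eq hv isOpen_Ioo hcont continuousOn_const
  have hd : ∀ x ∈ Set.Ioo (0 : ℝ) 1, d x = 0 := by
    intro x hx
    have h1 : HasDerivAt v (d x) x :=
      (i x (Set.Ioo_subset_Icc_self hx)).hasDerivAt (Icc_mem_nhds hx.1 hx.2)
    have h2 : HasDerivAt v 0 x :=
      (hasDerivAt_const x (0 : ℝ)).congr_of_eventuallyEq
        (hv0.eventuallyEq_of_mem (isOpen_Ioo.mem_nhds hx))
    exact h1.unique h2
  have hint := intervalIntegrable_coe f (Set.right_mem_Icc.2 zero_le_one)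
  have hL := hint.ae_hasDerivAt_integral
  rw [Lp.eq_zero_iff_ae_eq_zero]
  filter_upwards [ae_restrict_of_ae hL, ae_restrict_mem measurableSet_Ioo] with x hx hxI
  rw [Set.uIcc_of_le zero_le_one] at hx
  have h1 := hx (Set.Ioo_subset_Icc_self hxI) 0 (Set.left_mem_Icc.2 zero_le_one)
  have h2 : HasDerivAt (fun x => ∫ t in (0 : ℝ)..x, f t) 0 x := by
    refine (hasDerivAt_const x (d 0)).congr_of_eventuallyEq ?_
    filter_upwards [isOpen_Ioo.mem_nhds hxI] with y hy
    have := j y (Set.Ioo_subset_Icc_self hy)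
    rw [hd y hy] at this
    linarith
  exact h1.unique h2

/-! ### Eigenfunctions and the spectral Galerkin projection

The index `k : ℕ` starts at `0`: `eigenvalue k` and `eigenfunction k` are the `(k+1)`-st ones. -/

/-- `λ = (k+1)² π²`. -/
noncomputable def eigenvalue (k : ℕ) : ℝ := ((k : ℝ) + 1) ^ 2 * Real.pi ^ 2

theorem memLp_sin (k : ℕ) :
    MemLp (fun x : ℝ => √2 * Real.sin (((k : ℝ) + 1) * Real.pi * x)) 2 leb01 := by
  refine MemLp.of_bound (Continuous.aestronglyMeasurable (by fun_prop)) (√2) (ae_of_all _ ?_)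
  intro x
  rw [norm_mul, Real.norm_of_nonneg (Real.sqrt_nonneg 2)]
  exact mul_le_of_le_one_right (Real.sqrt_nonneg 2) (Real.abs_sin_le_one _)

/-- `φ(x) = √2 sin((k+1) π x)`. -/
noncomputable def eigenfunction (k : ℕ) : U := (memLp_sin k).toLp _

theorem eigenfunction_mem_graph (k : ℕ) :
    (eigenfunction k, eigenvalue k • eigenfunction k) ∈ negLaplacianGraph := by
  set a : ℝ := ((k : ℝ) + 1) * Real.pi with ha
  have hsin : (eigenfunction k : ℝ → ℝ) =ᵐ[leb01] fun x => √2 * Real.sin (a * x) :=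
    (memLp_sin k).coeFn_toLp
  have hder : ∀ x : ℝ, HasDerivAt (fun x => √2 * Real.sin (a * x)) (√2 * a * Real.cos (a * x)) x := by
    intro x
    have := (((hasDerivAt_id x).const_mul a).sin).const_mul (√2)
    refine this.congr_deriv ?_
    simp only [id, mul_one]
    ring
  have hder2 : ∀ x : ℝ, HasDerivAt (fun x => -(√2 * a * Real.cos (a * x)))
      (a ^ 2 * (√2 * Real.sin (a * x))) x := by
    intro x
    have := ((((hasDerivAt_id x).const_mul a).cos).const_mul (√2 * a)).neg
    refine this.congr_deriv ?_
    simp only [id, mul_one]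
    ring
  refine ⟨_, fun x => √2 * a * Real.cos (a * x), hsin, by simp, ?_,
    fun x _ => (hder x).hasDerivWithinAt, fun x hx => ?_⟩
  · have h := Real.sin_nat_mul_pi (k + 1)
    push_cast at h
    simp only [ha, mul_one, h, mul_zero]
  · have hlam : eigenvalue k = a ^ 2 := by rw [eigenvalue, ha, mul_pow]
    have h1 := integral_coe_smul (eigenvalue k) (eigenfunction k) hx
    have h2 : ∫ y in (0 : ℝ)..x, eigenfunction k y = ∫ y in (0 : ℝ)..x, √2 * Real.sin (a * y) := by
      simp only [intervalIntegral.integral_of_le hx.1, integral_Ioc_eq_integral_Ioo]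
      exact integral_congr_ae
        (ae_restrict_of_ae_restrict_of_subset (Set.Ioo_subset_Ioo_right hx.2) hsin)
    have h3 := intervalIntegral.integral_eq_sub_of_hasDerivAt (a := 0) (b := x)
      (fun y _ => hder2 y) (Continuous.intervalIntegrable (by fun_prop) _ _)
    rw [intervalIntegral.integral_const_mul] at h3
    change _ = _ - ∫ y in (0 : ℝ)..x, (eigenvalue k • eigenfunction k : U) y
    rw [h1, h2, hlam, h3]
    ring

/-- `A φ = λ φ`. -/
theorem negLaplacian_eigenfunction (k : ℕ) :
    ∃ h : eigenfunction k ∈ negLaplacian.domain,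
      negLaplacian ⟨eigenfunction k, h⟩ = eigenvalue k • eigenfunction k := by
  have hg : negLaplacian.graph = negLaplacianGraph :=
    Submodule.toLinearPMap_graph_eq _ negLaplacianGraph_functional
  have := eigenfunction_mem_graph k
  rw [← hg, LinearPMap.mem_graph_iff] at this
  obtain ⟨y, hy1, hy2⟩ := this
  obtain ⟨y, hy⟩ := y
  simp only at hy1 hy2
  subst hy1
  exact ⟨hy, hy2⟩

/-- `U^N`, the span of the first `N` eigenfunctions. -/
noncomputable def galerkinSpace (N : ℕ) : Submodule ℝ U :=
  Submodule.span ℝ (eigenfunction '' Set.Iio N)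

instance (N : ℕ) : FiniteDimensional ℝ (galerkinSpace N) :=
  FiniteDimensional.span_of_finite ℝ ((Set.finite_Iio N).image _)

theorem galerkinSpace_le_domain (N : ℕ) : galerkinSpace N ≤ negLaplacian.domain := by
  refine Submodule.span_le.2 ?_
  rintro _ ⟨k, -, rfl⟩
  exact (negLaplacian_eigenfunction k).1

/-- The orthogonal projection `P_N : U → U^N`. -/
noncomputable def galerkinProj (N : ℕ) : U →L[ℝ] galerkinSpace N :=
  (galerkinSpace N).orthogonalProjectionOnto

/-- `A_N = P_N A` on `U^N`. -/
noncomputable def galerkinA (N : ℕ) : galerkinSpace N →L[ℝ] galerkinSpace N :=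
  LinearMap.toContinuousLinearMap
    ((galerkinProj N).toLinearMap ∘ₗ negLaplacian.toFun ∘ₗ
      Submodule.inclusion (galerkinSpace_le_domain N))

/-- The operator semigroup `exp(-t B)` generated by `-B`, for a bounded operator `B`. -/
noncomputable def expSemigroup {V : Type*} [NormedAddCommGroup V] [NormedSpace ℝ V]
    (B : V →L[ℝ] V) (t : ℝ) : V →L[ℝ] V :=
  NormedSpace.exp (-(t • B))

/-- The semigroup `S_N^η(t) = exp(-t (A_N + η))` on `U^N`. -/
noncomputable def galerkinSemigroup (N : ℕ) (η t : ℝ) : galerkinSpace N →L[ℝ] galerkinSpace N :=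
  expSemigroup (galerkinA N + η • ContinuousLinearMap.id ℝ (galerkinSpace N)) t

/-! ### Fractional Brownian motion and the stochastic integral -/

section Noise

variable {Ω : Type*} [MeasurableSpace Ω]

/-- `(w t)_{t ∈ [0,T]}` is a standard real fractional Brownian motion of Hurst parameter `H`. -/
structure IsFBM (H T : ℝ) (w : ℝ → Ω → ℝ) (P : Measure Ω) : Prop where
  gaussian : IsGaussianProcess (fun t : Set.Icc (0 : ℝ) T => w t) P
  mean_zero : ∀ t ∈ Set.Icc (0 : ℝ) T, ∫ ω, w t ω ∂P = 0
  cov_eq : ∀ s ∈ Set.Icc (0 : ℝ) T, ∀ t ∈ Set.Icc (0 : ℝ) T,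
    cov[w s, w t; P] = 1 / 2 * (s ^ (2 * H) + t ^ (2 * H) - |t - s| ^ (2 * H))
  continuous_paths : ∀ᵐ ω ∂P, ContinuousOn (fun t => w t ω) (Set.Icc 0 T)

/-- The independent scalar fractional Brownian motions that define the cylindrical fractional
Brownian motion `∑ₖ wₖ φₖ` on `[0,T]` (`φₖ = eigenfunction k`). -/
structure IsCylindricalFBM (H T : ℝ) (w : ℕ → ℝ → Ω → ℝ) (P : Measure Ω) : Prop where
  isFBM : ∀ k, IsFBM H T (w k) P
  indep : iIndepFun (fun k ω => fun t : Set.Icc (0 : ℝ) T => w k t ω) P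

/-- The kernel `φ(y) = H (2H - 1) |y|^(2H-2)`. -/
noncomputable def fbmKernel (H y : ℝ) : ℝ := H * (2 * H - 1) * |y| ^ (2 * H - 2)

/-- A step function `∑_{i<n} cᵢ 1_{(τᵢ, τᵢ₊₁]}` on `[0,t]`, where `0 = τ₀ ≤ τ₁ ≤ ⋯ ≤ τₙ = t`. -/
structure StepFun (E : Type*) (t : ℝ) where
  n : ℕ
  τ : ℕ → ℝ
  mono : Monotone τ
  first : τ 0 = 0
  last : τ n = t
  c : ℕ → E

variable {E : Type*} [NormedAddCommGroup E] [NormedSpace ℝ E]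

/-- The value of the step function at `s`. -/
noncomputable def StepFun.eval {t : ℝ} (σ : StepFun E t) (s : ℝ) : E :=
  ∑ i ∈ Finset.range σ.n, (Set.Ioc (σ.τ i) (σ.τ (i + 1))).indicator (fun _ => σ.c i) s

/-- `∫₀ᵗ σ dw = ∑_{i<n} (w(τᵢ₊₁) - w(τᵢ)) cᵢ`. -/
noncomputable def StepFun.integral {t : ℝ} (σ : StepFun E t) (w : ℝ → Ω → ℝ) (ω : Ω) : E :=
  ∑ i ∈ Finset.range σ.n, (w (σ.τ (i + 1)) ω - w (σ.τ i) ω) • σ.c i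

/-- `X = ∫₀ᵗ g(s) dw(s)`, for a deterministic `E`-valued integrand `g` and a scalar fractional
Brownian motion `w` of Hurst parameter `H > 1/2`: `X` is the mean-square limit of the integrals of
step functions which converge to `g` in the norm
`|h|² = ∫₀ᵗ ∫₀ᵗ ‖h(u)‖ ‖h(v)‖ φ(u - v) du dv`. -/
structure HasWienerIntegral (H : ℝ) (P : Measure Ω) (w : ℝ → Ω → ℝ) (t : ℝ) (g : ℝ → E)
    (X : Ω → E) : Prop where
  aestronglyMeasurable : AEStronglyMeasurable g (volume.restrict (Set.Icc 0 t))
  memLp : MemLp X 2 P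
  approx : ∃ σ : ℕ → StepFun E t,
    Tendsto (fun m => ∫⁻ u in Set.Icc 0 t, ∫⁻ v in Set.Icc 0 t,
      ‖g u - (σ m).eval u‖ₑ * ‖g v - (σ m).eval v‖ₑ * ENNReal.ofReal (fbmKernel H (u - v)))
      atTop (𝓝 0) ∧
    Tendsto (fun m => eLpNorm (fun ω => X ω - (σ m).integral w ω) 2 P) atTop (𝓝 0)

/-- `Y = ∫₀ᵗ g(s) dB^H(s) = ∑ₖ ∫₀ᵗ g(s) φₖ dwₖ(s)`, the series converging in mean square. -/
structure HasCylindricalIntegral (H : ℝ) (P : Measure Ω) (w : ℕ → ℝ → Ω → ℝ) (t : ℝ)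
    (g : ℝ → U →L[ℝ] U) (Y : Ω → U) : Prop where
  memLp : MemLp Y 2 P
  series : ∃ X : ℕ → Ω → U,
    (∀ k, HasWienerIntegral H P (w k) t (fun s => g s (eigenfunction k)) (X k)) ∧
    Tendsto (fun n => eLpNorm (fun ω => Y ω - ∑ k ∈ Finset.range n, X k ω) 2 P) atTop (𝓝 0)

/-- `O` is a (jointly measurable version of the) stochastic convolution
`O_t = ∫₀ᵗ S_N^η(t-s) P_N dB^H(s)`, `t ∈ [0,T]`. -/
structure IsGalerkinConvolution (H T : ℝ) (P : Measure Ω) (w : ℕ → ℝ → Ω → ℝ) (N : ℕ) (η : ℝ)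
    (O : ℝ → Ω → U) : Prop where
  aestronglyMeasurable : AEStronglyMeasurable (fun p : ℝ × Ω => O p.1 p.2)
    ((volume.restrict (Set.Icc 0 T)).prod P)
  integral_eq : ∀ t ∈ Set.Icc (0 : ℝ) T, HasCylindricalIntegral H P w t
    (fun s => (galerkinSpace N).subtypeL ∘L galerkinSemigroup N η (t - s) ∘L galerkinProj N) (O t)

end Noise

end BurgersFBM

/-!
For `η > 0` the stochastic convolution takes values in the span of the first `N` eigenfunctions, and
its coordinates are the scalar Wiener integrals `ξⱼ(t) = ∫₀ᵗ exp(-(t-s)(λⱼ + η)) dwⱼ(s)`. These are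
limits in mean square of centered Gaussian variables, and their variances are at most `C / η`
uniformly in `t ∈ [0,T]`: one of the two exponentials in the energy
`∫₀ᵗ ∫₀ᵗ exp(-(t-u)(λⱼ + η)) exp(-(t-v)(λⱼ + η)) φ(u - v) du dv` is bounded by one, the kernel `φ` is
then integrated to a constant, and the other exponential has integral at most `1 / η`. So for each
`b` there is an `η` with `E exp(b ξⱼ(t)²) ≤ 2` for all `t`
(`IsCylindricalFBM.lintegral_exp_sq_coordinate_le`).

On the Galerkin space the square of the supremum norm is at most `2 N ∑ⱼ ξⱼ²`
(`eLpNorm_top_sq_le`). Jensen's inequality in time and Tonelli's theorem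
(`lintegral_exp_time_integral_le`) reduce the exponential moment of the time integral to exponential
moments at fixed times, and `exp (∑ⱼ aⱼ) ≤ 1 + ∑ⱼ exp (N aⱼ)` reduces these to the
coordinates.

Two facts about the Wiener integral carry the argument. The second moment of the integral of a step
function, with values in any inner product space, is at most its energy
(`IsFBM.lintegral_stepIntegral_sq_le`); hence integrals of the zero function vanish, and applying
linear maps to a vector-valued integral identifies it with its coordinates, without a uniqueness
theorem for the approximating step functions. Gaussian moments of step integrals pass to the limit by
Fatou's lemma (`IsFBM.lintegral_exp_sq_wienerIntegral_le`), so that Gaussianity of the limit is not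
needed.

The process exists because a continuously differentiable function has a Wiener integral given
pathwise by integration by parts (`IsFBM.hasWienerIntegral_byParts`): the error of the Riemann sums
is a sum of integrals of increments of `w` over the steps of the partition, which is small in mean
square. The resulting process has continuous paths, and is therefore jointly measurable
(`aestronglyMeasurable_of_continuous_paths`).
-/

namespace BurgersFBM

/-! ### The covariance kernel of fractional Brownian motion -/

theorem fbmKernel_nonneg {H : ℝ} (hH : 1 / 2 < H) (y : ℝ) : 0 ≤ fbmKernel H y :=
  mul_nonneg (mul_nonneg (by linarith) (by linarith)) (Real.rpow_nonneg (abs_nonneg y) _)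

theorem fbmKernel_neg (H y : ℝ) : fbmKernel H (-y) = fbmKernel H y := by
  simp only [fbmKernel, abs_neg]

theorem measurable_fbmKernel (H : ℝ) : Measurable (fbmKernel H) := by
  unfold fbmKernel
  fun_prop

theorem measurable_ofReal_fbmKernel_sub (H : ℝ) :
    Measurable fun p : ℝ × ℝ => ENNReal.ofReal (fbmKernel H (p.1 - p.2)) :=
  ENNReal.measurable_ofReal.comp ((measurable_fbmKernel H).comp (measurable_fst.sub measurable_snd))

theorem measurable_ofReal_fbmKernel_sub_right (H u : ℝ) :
    Measurable fun v : ℝ => ENNReal.ofReal (fbmKernel H (u - v)) :=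
  ENNReal.measurable_ofReal.comp ((measurable_fbmKernel H).comp (measurable_const.sub measurable_id))

/-- The odd primitive `H sign(x) |x|^(2H-1)` of `fbmKernel H`; it is also the derivative of
`|x|^(2H) / 2`. -/
noncomputable def fbmKernelPrimitive (H x : ℝ) : ℝ := H * |x| ^ (2 * H - 2) * x

theorem fbmKernelPrimitive_neg (H x : ℝ) :
    fbmKernelPrimitive H (-x) = -fbmKernelPrimitive H x := by
  simp only [fbmKernelPrimitive, abs_neg, mul_neg]

theorem fbmKernelPrimitive_nonneg {H x : ℝ} (hH : 1 / 2 < H) (hx : 0 ≤ x) :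
    0 ≤ fbmKernelPrimitive H x :=
  mul_nonneg (mul_nonneg (by linarith) (Real.rpow_nonneg (abs_nonneg x) _)) hx

theorem hasDerivAt_half_abs_rpow {H : ℝ} (hH : 1 / 2 < H) (x : ℝ) :
    HasDerivAt (fun x : ℝ => 1 / 2 * |x| ^ (2 * H)) (fbmKernelPrimitive H x) x := by
  refine ((hasDerivAt_abs_rpow x (by linarith : 1 < 2 * H)).const_mul (1 / 2)).congr_deriv ?_
  unfold fbmKernelPrimitive
  ring

theorem continuous_fbmKernelPrimitive {H : ℝ} (hH : 1 / 2 < H) :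
    Continuous (fbmKernelPrimitive H) := by
  have h1 : ContDiff ℝ 1 fun x : ℝ => 1 / 2 * |x| ^ (2 * H) :=
    contDiff_const.mul (contDiff_norm_rpow (E := ℝ) (by linarith : 1 < 2 * H))
  have h2 : deriv (fun x : ℝ => 1 / 2 * |x| ^ (2 * H)) = fbmKernelPrimitive H :=
    funext fun x => (hasDerivAt_half_abs_rpow hH x).deriv
  exact h2 ▸ h1.continuous_deriv le_rfl

theorem hasDerivAt_fbmKernelPrimitive (H : ℝ) {x : ℝ} (hx : x ≠ 0) :
    HasDerivAt (fbmKernelPrimitive H) (fbmKernel H x) x := by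
  have h1 := (((hasDerivAt_abs hx).rpow_const (p := 2 * H - 2)
    (Or.inl (abs_ne_zero.2 hx))).const_mul H).mul (hasDerivAt_id x)
  refine h1.congr_deriv ?_
  have h2 : |x| ^ (2 * H - 2) = |x| ^ (2 * H - 2 - 1) * |x| := by
    rw [← Real.rpow_add_one (abs_ne_zero.2 hx)]
    ring_nf
  have h3 : (SignType.sign x : ℝ) * x = |x| := sign_mul_self x
  simp only [fbmKernel, id, mul_one]
  calc _ = H * (2 * H - 2) * |x| ^ (2 * H - 2 - 1) * ((SignType.sign x : ℝ) * x)
        + H * |x| ^ (2 * H - 2) := by ring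
    _ = _ := by rw [h3, h2]; ring

theorem intervalIntegrable_fbmKernel {H : ℝ} (hH : 1 / 2 < H) (a b : ℝ) :
    IntervalIntegrable (fbmKernel H) volume a b := by
  have hpos : ∀ b : ℝ, 0 ≤ b → IntervalIntegrable (fbmKernel H) volume 0 b := by
    intro b hb
    refine ((intervalIntegral.intervalIntegrable_rpow' (a := 0) (b := b)
      (by linarith : -1 < 2 * H - 2)).const_mul (H * (2 * H - 1))).congr ?_
    intro x hx
    rw [Set.uIoc_of_le hb] at hx
    simp only [fbmKernel, abs_of_pos hx.1]
  have hall : ∀ b : ℝ, IntervalIntegrable (fbmKernel H) volume 0 b := by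
    intro b
    rcases le_total 0 b with hb | hb
    · exact hpos b hb
    · have := IntervalIntegrable.comp_sub_left (hpos (-b) (by linarith)) 0
      simpa only [zero_sub, fbmKernel_neg, neg_neg, neg_zero] using this
  exact (hall a).symm.trans (hall b)

theorem integral_fbmKernel {H : ℝ} (hH : 1 / 2 < H) (a b : ℝ) :
    ∫ x in a..b, fbmKernel H x = fbmKernelPrimitive H b - fbmKernelPrimitive H a :=
  integral_eq_of_hasDerivAt_off_countable _ _ (Set.countable_singleton (0 : ℝ))
    (continuous_fbmKernelPrimitive hH).continuousOn
    (fun _ hx => hasDerivAt_fbmKernelPrimitive H hx.2) (intervalIntegrable_fbmKernel hH a b)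

theorem monotone_fbmKernelPrimitive {H : ℝ} (hH : 1 / 2 < H) : Monotone (fbmKernelPrimitive H) := by
  intro a b hab
  have := intervalIntegral.integral_nonneg (μ := volume) hab fun x _ => fbmKernel_nonneg hH x
  rw [integral_fbmKernel hH] at this
  linarith

theorem lintegral_Ioc_fbmKernel {H : ℝ} (hH : 1 / 2 < H) (u : ℝ) {c d : ℝ} (hcd : c ≤ d) :
    ∫⁻ v in Set.Ioc c d, ENNReal.ofReal (fbmKernel H (u - v)) =
      ENNReal.ofReal (fbmKernelPrimitive H (u - c) - fbmKernelPrimitive H (u - d)) := by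
  have hi : IntervalIntegrable (fun v => fbmKernel H (u - v)) volume c d := by
    have := (intervalIntegrable_fbmKernel hH (u - c) (u - d)).comp_sub_left u
    simpa only [sub_sub_cancel] using this
  rw [← ofReal_integral_eq_lintegral_ofReal
    ((intervalIntegrable_iff_integrableOn_Ioc_of_le hcd).1 hi)
    (ae_of_all _ fun v => fbmKernel_nonneg hH _), ← intervalIntegral.integral_of_le hcd,
    intervalIntegral.integral_comp_sub_left (fun x => fbmKernel H x), integral_fbmKernel hH]

/-- The integral of the kernel over a rectangle is the covariance of the corresponding increments
of fractional Brownian motion. -/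
theorem lintegral_rectangle_fbmKernel {H : ℝ} (hH : 1 / 2 < H) {a b c d : ℝ} (hab : a ≤ b)
    (hcd : c ≤ d) :
    ∫⁻ u in Set.Ioc a b, ∫⁻ v in Set.Ioc c d, ENNReal.ofReal (fbmKernel H (u - v)) =
      ENNReal.ofReal (1 / 2 * |b - c| ^ (2 * H) - 1 / 2 * |a - c| ^ (2 * H)
        - (1 / 2 * |b - d| ^ (2 * H) - 1 / 2 * |a - d| ^ (2 * H))) := by
  simp only [lintegral_Ioc_fbmKernel hH _ hcd]
  have hc : ∀ z : ℝ, Continuous fun u => fbmKernelPrimitive H (u - z) := fun z =>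
    (continuous_fbmKernelPrimitive hH).comp (continuous_sub_right z)
  have hint : ∀ z : ℝ, ∫ u in a..b, fbmKernelPrimitive H (u - z)
      = 1 / 2 * |b - z| ^ (2 * H) - 1 / 2 * |a - z| ^ (2 * H) := fun z =>
    intervalIntegral.integral_eq_sub_of_hasDerivAt
      (f := fun u => 1 / 2 * |u - z| ^ (2 * H))
      (fun u _ => (hasDerivAt_half_abs_rpow hH (u - z)).comp_sub_const u z)
      ((hc z).intervalIntegrable _ _)
  rw [← ofReal_integral_eq_lintegral_ofReal, ← intervalIntegral.integral_of_le hab,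
    intervalIntegral.integral_sub ((hc c).intervalIntegrable _ _)
      ((hc d).intervalIntegrable _ _), hint, hint]
  · exact (intervalIntegrable_iff_integrableOn_Ioc_of_le hab).1
      (((hc c).sub (hc d)).intervalIntegrable _ _)
  · exact ae_of_all _ fun u => sub_nonneg.2 (monotone_fbmKernelPrimitive hH (by linarith))

theorem rectangle_increment_nonneg {H : ℝ} (hH : 1 / 2 < H) {a b c d : ℝ} (hab : a ≤ b)
    (hcd : c ≤ d) :
    0 ≤ 1 / 2 * |b - c| ^ (2 * H) - 1 / 2 * |a - c| ^ (2 * H)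
        - (1 / 2 * |b - d| ^ (2 * H) - 1 / 2 * |a - d| ^ (2 * H)) := by
  have hder : ∀ u, HasDerivAt
      (fun u => 1 / 2 * |u - c| ^ (2 * H) - 1 / 2 * |u - d| ^ (2 * H))
      (fbmKernelPrimitive H (u - c) - fbmKernelPrimitive H (u - d)) u := fun u =>
    ((hasDerivAt_half_abs_rpow hH (u - c)).comp_sub_const u c).sub
      ((hasDerivAt_half_abs_rpow hH (u - d)).comp_sub_const u d)
  have hmono := monotone_of_deriv_nonneg (fun u => (hder u).differentiableAt) fun u => by
    rw [(hder u).deriv]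
    exact sub_nonneg.2 (monotone_fbmKernelPrimitive hH (by linarith))
  have := hmono hab
  simp only at this
  linarith

theorem lintegral_Icc_fbmKernel_le {H : ℝ} (hH : 1 / 2 < H) {t T u : ℝ} (htT : t ≤ T)
    (hu : u ∈ Set.Icc 0 t) :
    ∫⁻ v in Set.Icc 0 t, ENNReal.ofReal (fbmKernel H (u - v)) ≤
      ENNReal.ofReal (2 * fbmKernelPrimitive H T) := by
  rw [← restrict_Ioc_eq_restrict_Icc, lintegral_Ioc_fbmKernel hH u (hu.1.trans hu.2)]
  refine ENNReal.ofReal_le_ofReal ?_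
  have h1 := monotone_fbmKernelPrimitive hH (show u - 0 ≤ T by linarith [hu.2])
  have h2 := monotone_fbmKernelPrimitive hH (show -T ≤ u - t by linarith [hu.1])
  rw [fbmKernelPrimitive_neg] at h2
  linarith

/-- On `[0,T]` the kernel is bounded below off the diagonal, because its exponent is negative. -/
theorem fbmKernel_lower_bound {H : ℝ} (hH : 1 / 2 < H) (hH1 : H < 1) {T y : ℝ}
    (hy0 : y ≠ 0) (hy : |y| ≤ T) : fbmKernel H T ≤ fbmKernel H y := by
  have h0 : 0 < |y| := abs_pos.2 hy0
  refine mul_le_mul_of_nonneg_left ?_ (mul_nonneg (by linarith) (by linarith))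
  rw [abs_of_pos (h0.trans_le hy)]
  exact Real.rpow_le_rpow_of_nonpos h0 hy (by linarith)

theorem fbmKernel_pos {H : ℝ} (hH : 1 / 2 < H) {y : ℝ} (hy : y ≠ 0) : 0 < fbmKernel H y :=
  mul_pos (mul_pos (by linarith) (by linarith)) (Real.rpow_pos_of_pos (abs_pos.2 hy) _)

/-! ### Second moments of integrals of step functions -/

/-- The double integral `∫₀ᵗ ∫₀ᵗ f(u) g(v) φ(u - v) du dv` against the covariance kernel `φ`. -/
noncomputable def kernelEnergy (H t : ℝ) (f g : ℝ → ℝ≥0∞) : ℝ≥0∞ :=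
  ∫⁻ u in Set.Icc 0 t, ∫⁻ v in Set.Icc 0 t, f u * g v * ENNReal.ofReal (fbmKernel H (u - v))

section StepFun

variable {E : Type*} {t : ℝ}

theorem StepFun.τ_mem (σ : StepFun E t) {i : ℕ} (hi : i ≤ σ.n) : σ.τ i ∈ Set.Icc 0 t :=
  ⟨σ.first.ge.trans (σ.mono (Nat.zero_le i)), (σ.mono hi).trans σ.last.le⟩

/-- The intervals of the step function cover `(0,t]`. -/
theorem StepFun.exists_mem_Ioc (σ : StepFun E t) {s : ℝ} (hs : s ∈ Set.Ioc 0 t) :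
    ∃ i < σ.n, s ∈ Set.Ioc (σ.τ i) (σ.τ (i + 1)) := by
  classical
  have hex : ∃ i, s ≤ σ.τ i := ⟨σ.n, hs.2.trans σ.last.ge⟩
  have h0 : Nat.find hex ≠ 0 := by
    intro h
    have := Nat.find_spec hex
    rw [h, σ.first] at this
    exact absurd hs.1 (not_lt.2 this)
  obtain ⟨i, hi⟩ := Nat.exists_eq_succ_of_ne_zero h0
  refine ⟨i, ?_, ?_, ?_⟩
  · have := Nat.find_min' hex (hs.2.trans σ.last.ge)
    omega
  · exact not_le.1 (Nat.find_min hex (by omega : i < Nat.find hex))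
  · have := Nat.find_spec hex
    rwa [hi] at this

variable [NormedAddCommGroup E]

theorem StepFun.eval_eq_of_mem (σ : StepFun E t) {i : ℕ} (hi : i < σ.n) {s : ℝ}
    (hs : s ∈ Set.Ioc (σ.τ i) (σ.τ (i + 1))) : σ.eval s = σ.c i := by
  rw [StepFun.eval, Finset.sum_eq_single_of_mem i (Finset.mem_range.2 hi),
    Set.indicator_of_mem hs]
  intro j _ hj
  exact Set.indicator_of_notMem
    (fun h => Set.disjoint_left.1 (σ.mono.pairwise_disjoint_on_Ioc_succ hj) h hs) _

theorem StepFun.enorm_eval (σ : StepFun E t) (s : ℝ) :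
    ‖σ.eval s‖ₑ = ∑ i ∈ Finset.range σ.n,
      (Set.Ioc (σ.τ i) (σ.τ (i + 1))).indicator (fun _ => ‖σ.c i‖ₑ) s := by
  by_cases h : ∃ i < σ.n, s ∈ Set.Ioc (σ.τ i) (σ.τ (i + 1))
  · obtain ⟨i, hi, hs⟩ := h
    rw [σ.eval_eq_of_mem hi hs, Finset.sum_eq_single_of_mem i (Finset.mem_range.2 hi),
      Set.indicator_of_mem hs]
    intro j _ hj
    exact Set.indicator_of_notMem
      (fun h => Set.disjoint_left.1 (σ.mono.pairwise_disjoint_on_Ioc_succ hj) h hs) _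
  · push Not at h
    have h1 : σ.eval s = 0 := Finset.sum_eq_zero fun i hi =>
      Set.indicator_of_notMem (h i (Finset.mem_range.1 hi)) _
    rw [h1, enorm_zero]
    exact (Finset.sum_eq_zero fun i hi =>
      Set.indicator_of_notMem (h i (Finset.mem_range.1 hi)) _).symm

theorem StepFun.stronglyMeasurable_eval (σ : StepFun E t) : StronglyMeasurable σ.eval := by
  have : σ.eval = fun s => ∑ i ∈ Finset.range σ.n,
      (Set.Ioc (σ.τ i) (σ.τ (i + 1))).indicator (fun _ => σ.c i) s := rfl
  rw [this]
  exact Finset.stronglyMeasurable_fun_sum _ fun i _ =>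
    stronglyMeasurable_const.indicator measurableSet_Ioc

theorem lintegral_lintegral_sum_indicator {k : ℝ × ℝ → ℝ≥0∞} (hk : Measurable k) {n : ℕ}
    {A : ℕ → Set ℝ} (hA : ∀ i, MeasurableSet (A i)) {S : Set ℝ}
    (hS : ∀ i ∈ Finset.range n, A i ⊆ S) (a : ℕ → ℝ≥0∞) :
    ∫⁻ u in S, ∫⁻ v in S, (∑ i ∈ Finset.range n, (A i).indicator (fun _ => a i) u) *
        (∑ i ∈ Finset.range n, (A i).indicator (fun _ => a i) v) * k (u, v) =
      ∑ i ∈ Finset.range n, ∑ j ∈ Finset.range n,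
        a i * a j * ∫⁻ u in A i, ∫⁻ v in A j, k (u, v) := by
  have hkv : ∀ u : ℝ, Measurable fun v => k (u, v) := fun u => hk.comp measurable_prodMk_left
  have hmu : ∀ j : ℕ, Measurable fun u => ∫⁻ v in A j, k (u, v) := fun j =>
    Measurable.lintegral_prod_right' hk
  have hin : ∀ u, ∫⁻ v in S, (∑ i ∈ Finset.range n, (A i).indicator (fun _ => a i) u) *
        (∑ i ∈ Finset.range n, (A i).indicator (fun _ => a i) v) * k (u, v) =
      ∑ i ∈ Finset.range n, ∑ j ∈ Finset.range n,
        (A i).indicator (fun u => a i * a j * ∫⁻ v in A j, k (u, v)) u := by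
    intro u
    have h1 : ∀ v, (∑ i ∈ Finset.range n, (A i).indicator (fun _ => a i) u) *
        (∑ i ∈ Finset.range n, (A i).indicator (fun _ => a i) v) * k (u, v) =
        ∑ i ∈ Finset.range n, ∑ j ∈ Finset.range n,
          (A i).indicator (fun _ => a i) u * (A j).indicator (fun v => a j * k (u, v)) v := by
      intro v
      rw [Finset.sum_mul_sum, Finset.sum_mul]
      refine Finset.sum_congr rfl fun i _ => ?_
      rw [Finset.sum_mul]
      refine Finset.sum_congr rfl fun j _ => ?_
      rw [mul_assoc]
      by_cases hv : v ∈ A j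
      · simp only [Set.indicator_of_mem hv]
      · simp only [Set.indicator_of_notMem hv, zero_mul]
    have hm : ∀ j : ℕ, Measurable ((A j).indicator (fun v => a j * k (u, v))) := fun j =>
      ((hkv u).const_mul _).indicator (hA j)
    simp only [h1]
    rw [lintegral_finsetSum _ fun i _ =>
      Finset.measurable_fun_sum _ fun j _ => (hm j).const_mul _]
    refine Finset.sum_congr rfl fun i _ => ?_
    rw [lintegral_finsetSum _ fun j _ => (hm j).const_mul _]
    refine Finset.sum_congr rfl fun j hj => ?_
    rw [lintegral_const_mul _ (hm j), lintegral_indicator (hA j),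
      Measure.restrict_restrict (hA j), Set.inter_eq_left.2 (hS j hj),
      lintegral_const_mul _ (hkv u)]
    by_cases hu : u ∈ A i
    · simp only [Set.indicator_of_mem hu, mul_assoc]
    · simp only [Set.indicator_of_notMem hu, zero_mul]
  have hmi : ∀ i j : ℕ, Measurable ((A i).indicator
      (fun u => a i * a j * ∫⁻ v in A j, k (u, v))) :=
    fun i j => ((hmu j).const_mul _).indicator (hA i)
  simp only [hin]
  rw [lintegral_finsetSum _ fun i _ => Finset.measurable_fun_sum _ fun j _ => hmi i j]
  refine Finset.sum_congr rfl fun i hi => ?_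
  rw [lintegral_finsetSum _ fun j _ => hmi i j]
  refine Finset.sum_congr rfl fun j _ => ?_
  rw [lintegral_indicator (hA i), Measure.restrict_restrict (hA i),
    Set.inter_eq_left.2 (hS i hi), lintegral_const_mul _ (hmu j)]

theorem StepFun.kernelEnergy_eval (σ : StepFun E t) (H : ℝ) :
    kernelEnergy H t (fun u => ‖σ.eval u‖ₑ) (fun u => ‖σ.eval u‖ₑ) =
      ∑ i ∈ Finset.range σ.n, ∑ j ∈ Finset.range σ.n, ‖σ.c i‖ₑ * ‖σ.c j‖ₑ *
        ∫⁻ u in Set.Ioc (σ.τ i) (σ.τ (i + 1)), ∫⁻ v in Set.Ioc (σ.τ j) (σ.τ (j + 1)),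
          ENNReal.ofReal (fbmKernel H (u - v)) := by
  have hsub : ∀ i ∈ Finset.range σ.n, Set.Ioc (σ.τ i) (σ.τ (i + 1)) ⊆ Set.Icc 0 t := by
    intro i hi x hx
    have hi := Finset.mem_range.1 hi
    exact ⟨(σ.τ_mem hi.le).1.trans hx.1.le, hx.2.trans (σ.τ_mem hi).2⟩
  unfold kernelEnergy
  simp only [StepFun.enorm_eval]
  exact lintegral_lintegral_sum_indicator (measurable_ofReal_fbmKernel_sub H)
    (fun _ => measurableSet_Ioc) hsub _

end StepFun

section FBM

variable {Ω : Type*} [MeasurableSpace Ω] {P : Measure Ω} {H T : ℝ} {w : ℝ → Ω → ℝ}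

theorem IsFBM.memLp (hw : IsFBM H T w P) {t : ℝ} (ht : t ∈ Set.Icc 0 T) : MemLp (w t) 2 P :=
  (hw.gaussian.hasGaussianLaw_eval ⟨t, ht⟩).memLp_two

theorem IsFBM.integral_mul_increments [IsProbabilityMeasure P] (hw : IsFBM H T w P) {a b c d : ℝ}
    (ha : a ∈ Set.Icc 0 T) (hb : b ∈ Set.Icc 0 T) (hc : c ∈ Set.Icc 0 T) (hd : d ∈ Set.Icc 0 T) :
    ∫ ω, (w b ω - w a ω) * (w d ω - w c ω) ∂P =
      1 / 2 * |b - c| ^ (2 * H) - 1 / 2 * |a - c| ^ (2 * H)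
        - (1 / 2 * |b - d| ^ (2 * H) - 1 / 2 * |a - d| ^ (2 * H)) := by
  have hma := hw.memLp ha
  have hmb := hw.memLp hb
  have hmc := hw.memLp hc
  have hmd := hw.memLp hd
  have h1 := covariance_fun_sub_fun_sub hmb hma hmd hmc
  have h2 : cov[fun ω => w b ω - w a ω, fun ω => w d ω - w c ω; P]
      = ∫ ω, (w b ω - w a ω) * (w d ω - w c ω) ∂P := by
    have h3 : ∫ ω, (w b ω - w a ω) ∂P = 0 := by
      rw [integral_sub (hmb.integrable one_le_two) (hma.integrable one_le_two),
        hw.mean_zero b hb, hw.mean_zero a ha, sub_zero]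
    refine (covariance_eq_sub (hmb.sub hma) (hmd.sub hmc)).trans ?_
    have h4 : P[w b - w a] = 0 := h3
    rw [h4, zero_mul, sub_zero]
    rfl
  rw [← h2]
  refine h1.trans ?_
  rw [hw.cov_eq b hb d hd, hw.cov_eq b hb c hc, hw.cov_eq a ha d hd, hw.cov_eq a ha c hc,
    abs_sub_comm d b, abs_sub_comm c b, abs_sub_comm d a, abs_sub_comm c a]
  ring

theorem IsFBM.memLp_stepIntegral {E : Type*} [NormedAddCommGroup E] [NormedSpace ℝ E]
    (hw : IsFBM H T w P) {t : ℝ} (ht : t ≤ T) (σ : StepFun E t) : MemLp (σ.integral w) 2 P := by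
  have : σ.integral w = fun ω => ∑ i ∈ Finset.range σ.n,
      (w (σ.τ (i + 1)) ω - w (σ.τ i) ω) • σ.c i := rfl
  rw [this]
  refine memLp_finsetSum _ fun i hi => ?_
  have hi := Finset.mem_range.1 hi
  have hT : Set.Icc 0 t ⊆ Set.Icc 0 T := Set.Icc_subset_Icc_right ht
  exact (memLp_top_const (σ.c i)).smul
    ((hw.memLp (hT (σ.τ_mem hi))).sub (hw.memLp (hT (σ.τ_mem hi.le))))

/-- The second moment of the integral of a step function is at most its energy. Increments of
fractional Brownian motion are nonnegatively correlated for `H > 1/2`, so that inner products of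
the coefficients may be replaced by products of norms. -/
theorem IsFBM.lintegral_stepIntegral_sq_le {E : Type*} [NormedAddCommGroup E]
    [InnerProductSpace ℝ E] [IsProbabilityMeasure P] (hw : IsFBM H T w P) (hH : 1 / 2 < H)
    {t : ℝ} (ht : t ≤ T) (σ : StepFun E t) :
    ∫⁻ ω, ‖σ.integral w ω‖ₑ ^ 2 ∂P ≤
      kernelEnergy H t (fun u => ‖σ.eval u‖ₑ) (fun u => ‖σ.eval u‖ₑ) := by
  have hT : Set.Icc 0 t ⊆ Set.Icc 0 T := Set.Icc_subset_Icc_right ht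
  have hmem : ∀ i ∈ Finset.range σ.n, σ.τ i ∈ Set.Icc 0 T ∧ σ.τ (i + 1) ∈ Set.Icc 0 T := by
    intro i hi
    have hi := Finset.mem_range.1 hi
    exact ⟨hT (σ.τ_mem hi.le), hT (σ.τ_mem hi)⟩
  set D : ℕ → Ω → ℝ := fun i ω => w (σ.τ (i + 1)) ω - w (σ.τ i) ω with hD
  have hDm : ∀ i ∈ Finset.range σ.n, MemLp (D i) 2 P := fun i hi =>
    (hw.memLp (hmem i hi).2).sub (hw.memLp (hmem i hi).1)
  have hcov : ∀ i ∈ Finset.range σ.n, ∀ j ∈ Finset.range σ.n,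
      0 ≤ ∫ ω, D i ω * D j ω ∂P ∧ ENNReal.ofReal (∫ ω, D i ω * D j ω ∂P) =
        ∫⁻ u in Set.Ioc (σ.τ i) (σ.τ (i + 1)), ∫⁻ v in Set.Ioc (σ.τ j) (σ.τ (j + 1)),
          ENNReal.ofReal (fbmKernel H (u - v)) := by
    intro i hi j hj
    have h1 := hw.integral_mul_increments (hmem i hi).1 (hmem i hi).2 (hmem j hj).1 (hmem j hj).2
    have h2 := lintegral_rectangle_fbmKernel hH (σ.mono i.le_succ) (σ.mono j.le_succ)
    exact ⟨(rectangle_increment_nonneg hH (σ.mono i.le_succ) (σ.mono j.le_succ)).trans_eq h1.symm,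
      by rw [h2, ← h1]⟩
  have hsq : ∀ ω, ‖σ.integral w ω‖ ^ 2 = ∑ i ∈ Finset.range σ.n, ∑ j ∈ Finset.range σ.n,
      D i ω * D j ω * inner ℝ (σ.c i) (σ.c j) := by
    intro ω
    rw [← real_inner_self_eq_norm_sq, StepFun.integral, sum_inner]
    refine Finset.sum_congr rfl fun i _ => ?_
    rw [inner_sum]
    refine Finset.sum_congr rfl fun j _ => ?_
    rw [real_inner_smul_left, real_inner_smul_right, mul_assoc]
  have hint : ∀ i ∈ Finset.range σ.n, ∀ j ∈ Finset.range σ.n,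
      Integrable (fun ω => D i ω * D j ω * inner ℝ (σ.c i) (σ.c j)) P := fun i hi j hj =>
    ((hDm i hi).integrable_mul (hDm j hj)).mul_const _
  have hE : ∫⁻ ω, ‖σ.integral w ω‖ₑ ^ 2 ∂P = ENNReal.ofReal (∫ ω, ‖σ.integral w ω‖ ^ 2 ∂P) := by
    rw [ofReal_integral_eq_lintegral_ofReal]
    · refine lintegral_congr fun ω => ?_
      rw [ENNReal.ofReal_pow (norm_nonneg _), ofReal_norm]
    · simp only [hsq]
      exact integrable_finsetSum _ fun i hi => integrable_finsetSum _ fun j hj => hint i hi j hj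
    · exact ae_of_all _ fun ω => by positivity
  rw [hE, σ.kernelEnergy_eval]
  simp only [hsq]
  rw [integral_finsetSum _ fun i hi => integrable_finsetSum _ fun j hj => hint i hi j hj]
  refine (ENNReal.ofReal_le_ofReal (Finset.sum_le_sum fun i hi => ?_ : _ ≤
    ∑ i ∈ Finset.range σ.n, ∑ j ∈ Finset.range σ.n,
      ‖σ.c i‖ * ‖σ.c j‖ * ∫ ω, D i ω * D j ω ∂P)).trans_eq ?_
  · rw [integral_finsetSum _ fun j hj => hint i hi j hj]
    refine Finset.sum_le_sum fun j hj => ?_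
    rw [integral_mul_const, mul_comm]
    exact mul_le_mul_of_nonneg_right (real_inner_le_norm _ _) (hcov i hi j hj).1
  · have hnn : ∀ i ∈ Finset.range σ.n, ∀ j ∈ Finset.range σ.n,
        0 ≤ ‖σ.c i‖ * ‖σ.c j‖ * ∫ ω, D i ω * D j ω ∂P := fun i hi j hj =>
      mul_nonneg (by positivity) (hcov i hi j hj).1
    rw [ENNReal.ofReal_sum_of_nonneg fun i hi => Finset.sum_nonneg fun j hj => hnn i hi j hj]
    refine Finset.sum_congr rfl fun i hi => ?_
    rw [ENNReal.ofReal_sum_of_nonneg fun j hj => hnn i hi j hj]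
    refine Finset.sum_congr rfl fun j hj => ?_
    rw [ENNReal.ofReal_mul (by positivity), ENNReal.ofReal_mul (norm_nonneg _), ofReal_norm,
      ofReal_norm, (hcov i hi j hj).2]

theorem IsFBM.integral_stepIntegral (hw : IsFBM H T w P) [IsProbabilityMeasure P]
    {t : ℝ} (ht : t ≤ T) (σ : StepFun ℝ t) : ∫ ω, σ.integral w ω ∂P = 0 := by
  have hT : Set.Icc 0 t ⊆ Set.Icc 0 T := Set.Icc_subset_Icc_right ht
  have hi1 : ∀ i ≤ σ.n, Integrable (w (σ.τ i)) P := fun i hi =>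
    (hw.memLp (hT (σ.τ_mem hi))).integrable one_le_two
  simp only [StepFun.integral, smul_eq_mul]
  have hi2 : ∀ i ∈ Finset.range σ.n,
      Integrable (fun ω => (w (σ.τ (i + 1)) ω - w (σ.τ i) ω) * σ.c i) P := fun i hi =>
    ((hi1 (i + 1) (Finset.mem_range.1 hi)).sub (hi1 i (Finset.mem_range.1 hi).le)).mul_const _
  rw [integral_finsetSum _ hi2]
  refine Finset.sum_eq_zero fun i hi => ?_
  have hi := Finset.mem_range.1 hi
  rw [integral_mul_const, integral_sub (hi1 _ hi) (hi1 _ hi.le),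
    hw.mean_zero _ (hT (σ.τ_mem hi)), hw.mean_zero _ (hT (σ.τ_mem hi.le)), sub_zero, zero_mul]

theorem IsFBM.hasGaussianLaw_stepIntegral (hw : IsFBM H T w P) {t : ℝ} (ht : t ≤ T)
    (σ : StepFun ℝ t) : HasGaussianLaw (σ.integral w) P := by
  have hT : Set.Icc 0 t ⊆ Set.Icc 0 T := Set.Icc_subset_Icc_right ht
  have h1 := hw.gaussian.hasGaussianLaw_increments (n := σ.n)
    (t := fun i => ⟨σ.τ i, hT (σ.τ_mem (Nat.lt_succ_iff.1 i.2))⟩)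
  have h2 := h1.map_fun (∑ i : Fin σ.n, σ.c i • ContinuousLinearMap.proj (R := ℝ) i)
  refine h2.congr (ae_of_all _ fun ω => ?_)
  simp [StepFun.integral, Finset.sum_range, mul_comm]

end FBM

/-! ### Energies against the covariance kernel -/

section Energy

variable {H t : ℝ} {f g h : ℝ → ℝ≥0∞}

theorem kernelEnergy_mono {f' h' : ℝ → ℝ≥0∞} (hf : ∀ u, f u ≤ f' u) (hh : ∀ u, h u ≤ h' u) :
    kernelEnergy H t f h ≤ kernelEnergy H t f' h' :=
  lintegral_mono fun _ => lintegral_mono fun _ => by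
    dsimp only
    gcongr
    · exact hf _
    · exact hh _

theorem kernelEnergy_eq_lintegral_mul (hh : AEMeasurable h (volume.restrict (Set.Icc 0 t))) :
    kernelEnergy H t f h = ∫⁻ u in Set.Icc 0 t, f u *
      ∫⁻ v in Set.Icc 0 t, h v * ENNReal.ofReal (fbmKernel H (u - v)) := by
  refine lintegral_congr fun u => ?_
  simp only [mul_assoc]
  exact lintegral_const_mul'' _
    (hh.mul (measurable_ofReal_fbmKernel_sub_right H u).aemeasurable)

theorem kernelEnergy_comm (hf : AEMeasurable f (volume.restrict (Set.Icc 0 t)))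
    (hh : AEMeasurable h (volume.restrict (Set.Icc 0 t))) :
    kernelEnergy H t f h = kernelEnergy H t h f := by
  have hm : AEMeasurable (Function.uncurry fun u v =>
      f u * h v * ENNReal.ofReal (fbmKernel H (u - v)))
      ((volume.restrict (Set.Icc 0 t)).prod (volume.restrict (Set.Icc 0 t))) :=
    (hf.comp_fst.mul hh.comp_snd).mul (measurable_ofReal_fbmKernel_sub H).aemeasurable
  unfold kernelEnergy
  rw [lintegral_lintegral_swap hm]
  refine lintegral_congr fun v => lintegral_congr fun u => ?_
  rw [← fbmKernel_neg, neg_sub, mul_comm (f u)]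

theorem kernelEnergy_add_left (hf : AEMeasurable f (volume.restrict (Set.Icc 0 t)))
    (hh : AEMeasurable h (volume.restrict (Set.Icc 0 t))) :
    kernelEnergy H t (f + g) h = kernelEnergy H t f h + kernelEnergy H t g h := by
  simp only [kernelEnergy_eq_lintegral_mul hh, Pi.add_apply, add_mul]
  refine lintegral_add_left' (hf.mul ?_) _
  exact AEMeasurable.lintegral_prod_right'
    (f := fun p : ℝ × ℝ => h p.2 * ENNReal.ofReal (fbmKernel H (p.1 - p.2)))
    (hh.comp_snd.mul (measurable_ofReal_fbmKernel_sub H).aemeasurable)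

theorem kernelEnergy_add_self (hf : AEMeasurable f (volume.restrict (Set.Icc 0 t)))
    (hg : AEMeasurable g (volume.restrict (Set.Icc 0 t))) :
    kernelEnergy H t (f + g) (f + g) =
      kernelEnergy H t f f + 2 * kernelEnergy H t g f + kernelEnergy H t g g := by
  rw [kernelEnergy_add_left hf (hf.add hg), kernelEnergy_comm hf (hf.add hg),
    kernelEnergy_comm hg (hf.add hg), kernelEnergy_add_left hf hf, kernelEnergy_add_left hf hg,
    kernelEnergy_comm hf hg, two_mul]
  ring

theorem kernelEnergy_le_of_le_one (hH : 1 / 2 < H) {T : ℝ} (ht : t ≤ T)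
    (hf : AEMeasurable f (volume.restrict (Set.Icc 0 t))) (h1 : ∀ u ∈ Set.Icc 0 t, h u ≤ 1) :
    kernelEnergy H t f h ≤
      ENNReal.ofReal (2 * fbmKernelPrimitive H T) * ∫⁻ u in Set.Icc 0 t, f u := by
  have h2 : ∀ u ∈ Set.Icc 0 t,
      ∫⁻ v in Set.Icc 0 t, f u * h v * ENNReal.ofReal (fbmKernel H (u - v)) ≤
        ENNReal.ofReal (2 * fbmKernelPrimitive H T) * f u := by
    intro u hu
    have h3 : ∫⁻ v in Set.Icc 0 t, f u * h v * ENNReal.ofReal (fbmKernel H (u - v)) ≤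
        ∫⁻ v in Set.Icc 0 t, f u * ENNReal.ofReal (fbmKernel H (u - v)) :=
      setLIntegral_mono' measurableSet_Icc fun v hv =>
        mul_le_mul_left (mul_le_of_le_one_right' (h1 v hv)) _
    refine h3.trans ?_
    rw [lintegral_const_mul _ (measurable_ofReal_fbmKernel_sub_right H u), mul_comm]
    exact mul_le_mul_left (lintegral_Icc_fbmKernel_le hH ht hu) _
  rw [← lintegral_const_mul'' _ hf]
  exact setLIntegral_mono' measurableSet_Icc h2

/-- The energy controls the square of the `L¹` norm, the kernel being bounded below on `[0,T]`. -/
theorem lintegral_sq_le_kernelEnergy (hH : 1 / 2 < H) (hH1 : H < 1) {T : ℝ} (ht : t ≤ T)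
    (hf : AEMeasurable f (volume.restrict (Set.Icc 0 t))) :
    ENNReal.ofReal (fbmKernel H T) * (∫⁻ u in Set.Icc 0 t, f u) ^ 2 ≤ kernelEnergy H t f f := by
  have h1 : ENNReal.ofReal (fbmKernel H T) * (∫⁻ u in Set.Icc 0 t, f u) ^ 2 =
      ∫⁻ u in Set.Icc 0 t, ∫⁻ v in Set.Icc 0 t, f u * f v * ENNReal.ofReal (fbmKernel H T) := by
    have : ∀ u, ∫⁻ v in Set.Icc 0 t, f u * f v * ENNReal.ofReal (fbmKernel H T) =
        ENNReal.ofReal (fbmKernel H T) * (∫⁻ v in Set.Icc 0 t, f v) * f u := by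
      intro u
      rw [lintegral_mul_const'' _ (hf.const_mul _), lintegral_const_mul'' _ hf]
      ring
    simp only [this]
    rw [lintegral_const_mul'' _ hf]
    ring
  rw [h1]
  refine setLIntegral_mono' measurableSet_Icc fun u hu => ?_
  refine lintegral_mono_ae ?_
  -- On the diagonal the kernel has the junk value `0`, because `0 ^ (2 * H - 2) = 0`.
  have hne : ∀ᵐ v ∂(volume.restrict (Set.Icc 0 t)), v ≠ u :=
    ae_restrict_of_ae (compl_mem_ae_iff.2 (measure_singleton u))
  filter_upwards [hne, ae_restrict_mem measurableSet_Icc] with v hv hvI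
  gcongr
  refine fbmKernel_lower_bound hH hH1 (sub_ne_zero.2 hv.symm) ?_
  rw [abs_le]
  constructor <;> linarith [hu.1, hu.2, hvI.1, hvI.2]

/-- If the energy of a sequence tends to zero, then so do its mixed energies with a bounded
function. -/
theorem tendsto_kernelEnergy_mixed (hH : 1 / 2 < H) (hH1 : H < 1) {T : ℝ} (hT : 0 < T) (ht : t ≤ T)
    {e : ℕ → ℝ → ℝ≥0∞} (he : ∀ m, AEMeasurable (e m) (volume.restrict (Set.Icc 0 t)))
    (h1 : ∀ u ∈ Set.Icc 0 t, h u ≤ 1)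
    (hlim : Tendsto (fun m => kernelEnergy H t (e m) (e m)) atTop (𝓝 0)) :
    Tendsto (fun m => kernelEnergy H t (e m) h) atTop (𝓝 0) := by
  have hK : ENNReal.ofReal (fbmKernel H T) ≠ 0 :=
    (ENNReal.ofReal_pos.2 (fbmKernel_pos hH hT.ne')).ne'
  have h2 : Tendsto (fun m => (∫⁻ u in Set.Icc 0 t, e m u) ^ 2) atTop (𝓝 0) := by
    have h3 : Tendsto (fun m => (ENNReal.ofReal (fbmKernel H T))⁻¹ *
        kernelEnergy H t (e m) (e m)) atTop (𝓝 0) := by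
      simpa using ENNReal.Tendsto.const_mul hlim (Or.inr (ENNReal.inv_ne_top.2 hK))
    refine tendsto_of_tendsto_of_tendsto_of_le_of_le tendsto_const_nhds h3
      (fun _ => zero_le) fun m => ?_
    rw [← ENNReal.mul_le_iff_le_inv hK ENNReal.ofReal_ne_top]
    exact lintegral_sq_le_kernelEnergy hH hH1 ht (he m)
  have h4 : Tendsto (fun m => ∫⁻ u in Set.Icc 0 t, e m u) atTop (𝓝 0) := by
    have := h2.ennrpow_const (1 / 2)
    simp only [← ENNReal.rpow_natCast, ← ENNReal.rpow_mul] at this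
    simpa using this
  have h5 := ENNReal.Tendsto.const_mul h4
    (Or.inr (ENNReal.ofReal_ne_top : ENNReal.ofReal (2 * fbmKernelPrimitive H T) ≠ ⊤))
  rw [mul_zero] at h5
  refine tendsto_of_tendsto_of_tendsto_of_le_of_le tendsto_const_nhds h5
    (fun _ => zero_le) fun m => kernelEnergy_le_of_le_one hH ht (he m) h1

end Energy

/-! ### Properties of the Wiener integral -/

section Wiener

variable {Ω : Type*} [MeasurableSpace Ω] {P : Measure Ω} {H T t : ℝ} {w : ℝ → Ω → ℝ}

/-- The image of a step function under a linear map. -/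
def StepFun.map {E F : Type*} [NormedAddCommGroup E] [NormedSpace ℝ E] [NormedAddCommGroup F]
    [NormedSpace ℝ F] (L : E →L[ℝ] F) (σ : StepFun E t) : StepFun F t where
  n := σ.n
  τ := σ.τ
  mono := σ.mono
  first := σ.first
  last := σ.last
  c := fun i => L (σ.c i)

section Map

variable {E F : Type*} [NormedAddCommGroup E] [NormedSpace ℝ E] [NormedAddCommGroup F]
    [NormedSpace ℝ F] (L : E →L[ℝ] F)

theorem StepFun.eval_map (σ : StepFun E t) (s : ℝ) : (σ.map L).eval s = L (σ.eval s) := by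
  rw [StepFun.eval, StepFun.eval, map_sum]
  refine Finset.sum_congr rfl fun i _ => ?_
  exact (congrFun (Set.indicator_comp_of_zero (s := Set.Ioc (σ.τ i) (σ.τ (i + 1)))
    (f := fun _ => σ.c i) L.map_zero) s)

theorem StepFun.integral_map {Ω' : Type*} (σ : StepFun E t) (w : ℝ → Ω' → ℝ) (ω : Ω') :
    (σ.map L).integral w ω = L (σ.integral w ω) := by
  rw [StepFun.integral, StepFun.integral, map_sum]
  refine Finset.sum_congr rfl fun i _ => ?_
  rw [map_smul]
  rfl

theorem HasWienerIntegral.map {g : ℝ → E} {X : Ω → E} (hX : HasWienerIntegral H P w t g X) :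
    HasWienerIntegral H P w t (fun s => L (g s)) (fun ω => L (X ω)) where
  aestronglyMeasurable := L.continuous.comp_aestronglyMeasurable hX.aestronglyMeasurable
  memLp := L.comp_memLp' hX.memLp
  approx := by
    obtain ⟨σ, h1, h2⟩ := hX.approx
    refine ⟨fun m => (σ m).map L, ?_, ?_⟩
    · have h3 := ENNReal.Tendsto.const_mul h1
        (Or.inr (ENNReal.mul_ne_top enorm_ne_top enorm_ne_top : ‖L‖ₑ * ‖L‖ₑ ≠ ⊤))
      rw [mul_zero] at h3
      refine tendsto_of_tendsto_of_tendsto_of_le_of_le tendsto_const_nhds h3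
        (fun _ => zero_le) fun m => ?_
      have hc : ‖L‖ₑ * ‖L‖ₑ ≠ ⊤ := ENNReal.mul_ne_top enorm_ne_top enorm_ne_top
      simp only [← lintegral_const_mul' _ _ hc]
      refine lintegral_mono fun u => lintegral_mono fun v => ?_
      simp only [StepFun.eval_map, ← map_sub]
      calc _ ≤ (‖L‖ₑ * ‖g u - (σ m).eval u‖ₑ) * (‖L‖ₑ * ‖g v - (σ m).eval v‖ₑ) *
            ENNReal.ofReal (fbmKernel H (u - v)) := by
            gcongr <;> exact L.le_opENorm _
        _ = _ := by ring
    · have h3 := ENNReal.Tendsto.const_mul h2 (Or.inr (enorm_ne_top : ‖L‖ₑ ≠ ⊤))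
      rw [mul_zero] at h3
      refine tendsto_of_tendsto_of_tendsto_of_le_of_le tendsto_const_nhds h3
        (fun _ => zero_le) fun m => ?_
      simp only [StepFun.integral_map, ← map_sub]
      exact eLpNorm_le_nnreal_smul_eLpNorm_of_ae_le_mul (c := ‖L‖₊)
        (ae_of_all _ fun ω => L.le_opNNNorm _) 2

end Map

theorem eLpNorm_two_sq {E : Type*} [NormedAddCommGroup E] (X : Ω → E) :
    eLpNorm X 2 P ^ 2 = ∫⁻ ω, ‖X ω‖ₑ ^ 2 ∂P := by
  have := eLpNorm_nnreal_pow_eq_lintegral (μ := P) (f := X) (p := 2) two_ne_zero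
  simpa using this

/-- The Wiener integral of the zero function vanishes: the integrals of the approximating step
functions are controlled by their energies, which tend to zero. -/
theorem IsFBM.wienerIntegral_zero {E : Type*} [NormedAddCommGroup E] [InnerProductSpace ℝ E]
    [IsProbabilityMeasure P] (hw : IsFBM H T w P) (hH : 1 / 2 < H) (ht : t ≤ T) {X : Ω → E}
    (hX : HasWienerIntegral H P w t (fun _ => 0) X) : X =ᵐ[P] 0 := by
  obtain ⟨σ, h1, h2⟩ := hX.approx
  have h3 : Tendsto (fun m => eLpNorm ((σ m).integral w) 2 P ^ 2) atTop (𝓝 0) := by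
    refine tendsto_of_tendsto_of_tendsto_of_le_of_le tendsto_const_nhds h1
      (fun _ => zero_le) fun m => ?_
    simp only [zero_sub, enorm_neg]
    rw [eLpNorm_two_sq]
    exact hw.lintegral_stepIntegral_sq_le hH ht (σ m)
  have h4 : Tendsto (fun m => eLpNorm ((σ m).integral w) 2 P) atTop (𝓝 0) := by
    have := h3.ennrpow_const (1 / 2)
    simp only [← ENNReal.rpow_natCast, ← ENNReal.rpow_mul] at this
    simpa using this
  have h5 : eLpNorm X 2 P ≤ 0 := by
    have h6 := h2.add h4
    rw [add_zero] at h6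
    refine ge_of_tendsto' h6 fun m => ?_
    have hS := (hw.memLp_stepIntegral ht (σ m)).aestronglyMeasurable
    have := eLpNorm_add_le (hX.memLp.aestronglyMeasurable.sub hS) hS one_le_two
    rwa [sub_add_cancel] at this
  exact (eLpNorm_eq_zero_iff hX.memLp.aestronglyMeasurable two_ne_zero).1 (nonpos_iff_eq_zero.1 h5)

/-! ### Exponential moments of squares of Gaussian variables -/

theorem lintegral_exp_sq_gaussianReal_le {v : NNReal} {b : ℝ} (hb : b * v ≤ 1 / 4) :
    ∫⁻ x, ENNReal.ofReal (Real.exp (b * x ^ 2)) ∂(gaussianReal 0 v) ≤ 2 := by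
  by_cases hv : v = 0
  · subst hv
    rw [gaussianReal_zero_var, lintegral_dirac]
    simp
  have hv0 : (0 : ℝ) < v := NNReal.coe_pos.2 (pos_iff_ne_zero.2 hv)
  -- The exponent of the product of the Gaussian density and `exp (b x ^ 2)` is `-q x ^ 2`, where
  -- `q = 1 / (2 v) - b` is at least half of `1 / (2 v)`.
  have hq : 1 / (4 * (v : ℝ)) ≤ 1 / (2 * v) - b := by
    have : b ≤ 1 / 4 / v := (le_div_iff₀ hv0).2 hb
    have h2 : 1 / (2 * (v : ℝ)) = 1 / 4 / v + 1 / (4 * v) := by field_simp; norm_num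
    linarith
  have hq0 : 0 < 1 / (2 * (v : ℝ)) - b := lt_of_lt_of_le (by positivity) hq
  rw [gaussianReal_of_var_ne_zero _ hv,
    lintegral_withDensity_eq_lintegral_mul _ (measurable_gaussianPDF 0 v) (by fun_prop)]
  have h1 : ∀ x, (gaussianPDF 0 v * fun x => ENNReal.ofReal (Real.exp (b * x ^ 2))) x =
      ENNReal.ofReal ((√(2 * Real.pi * v))⁻¹ * Real.exp (-(1 / (2 * v) - b) * x ^ 2)) := by
    intro x
    rw [Pi.mul_apply, gaussianPDF, ← ENNReal.ofReal_mul (gaussianPDFReal_nonneg 0 v x),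
      gaussianPDFReal, mul_assoc, ← Real.exp_add]
    congr 3
    field_simp
    ring
  simp only [h1]
  rw [← ofReal_integral_eq_lintegral_ofReal ((integrable_exp_neg_mul_sq hq0).const_mul _)
    (ae_of_all _ fun x => by positivity), integral_const_mul, integral_gaussian]
  have h2 : √(Real.pi / (1 / (2 * v) - b)) ≤ √(2 * (2 * Real.pi * v)) := by
    refine Real.sqrt_le_sqrt ?_
    rw [div_le_iff₀ hq0]
    calc Real.pi = 2 * (2 * Real.pi * v) * (1 / (4 * v)) := by field_simp; norm_num
      _ ≤ _ := by gcongr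
  have hpos : 0 < √(2 * Real.pi * v) := Real.sqrt_pos.2 (by positivity)
  refine (ENNReal.ofReal_le_ofReal (mul_le_mul_of_nonneg_left h2 (by positivity))).trans ?_
  rw [Real.sqrt_mul zero_le_two, mul_comm √2, inv_mul_cancel_left₀ hpos.ne']
  refine ENNReal.ofReal_le_of_le_toReal ?_
  rw [ENNReal.toReal_ofNat]
  exact (Real.sqrt_le_left (by norm_num)).2 (by norm_num)

theorem lintegral_exp_sq_le_of_hasGaussianLaw [IsProbabilityMeasure P] {X : Ω → ℝ}
    (hX : HasGaussianLaw X P) (h0 : ∫ ω, X ω ∂P = 0) {b δ : ℝ} (hb : 0 ≤ b) (hδ : 0 ≤ δ)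
    (hv : ∫⁻ ω, ‖X ω‖ₑ ^ 2 ∂P ≤ ENNReal.ofReal δ) (hbδ : b * δ ≤ 1 / 4) :
    ∫⁻ ω, ENNReal.ofReal (Real.exp (b * X ω ^ 2)) ∂P ≤ 2 := by
  have hm := hX.map_eq_gaussianReal
  have h1 : ∫⁻ ω, ENNReal.ofReal (Real.exp (b * X ω ^ 2)) ∂P =
      ∫⁻ x, ENNReal.ofReal (Real.exp (b * x ^ 2)) ∂(P.map X) :=
    (lintegral_map' (f := fun x => ENNReal.ofReal (Real.exp (b * x ^ 2)))
      (by fun_prop) hX.aemeasurable).symm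
  rw [h1, hm, h0]
  refine lintegral_exp_sq_gaussianReal_le ?_
  refine le_trans (mul_le_mul_of_nonneg_left ?_ hb) hbδ
  have hvar : Var[X; P] ≤ δ := by
    have hE : ENNReal.ofReal Var[X; P] = ∫⁻ ω, ‖X ω‖ₑ ^ 2 ∂P := by
      rw [hX.memLp_two.ofReal_variance_eq, evariance, h0]
      simp
    rw [← ENNReal.ofReal_le_ofReal_iff hδ, hE]
    exact hv
  rw [Real.coe_toNNReal _ (variance_nonneg _ _)]
  exact hvar

/-- Exponential square moments of Wiener integrals of integrands that are bounded by one and small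
in `L¹`. The second moments of the approximating Gaussian step integrals are eventually at most
`δ`, and the bound passes to the limit by Fatou's lemma. -/
theorem IsFBM.lintegral_exp_sq_wienerIntegral_le [IsProbabilityMeasure P] (hw : IsFBM H T w P)
    (hH : 1 / 2 < H) (hH1 : H < 1) (hT : 0 < T) (ht : t ≤ T) {g : ℝ → ℝ} {X : Ω → ℝ}
    (hX : HasWienerIntegral H P w t g X) (hg : ∀ u ∈ Set.Icc 0 t, ‖g u‖ₑ ≤ 1)
    {b δ : ℝ} (hb : 0 ≤ b) (hδ : 0 ≤ δ) (hbδ : b * δ ≤ 1 / 4)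
    (hgδ : ENNReal.ofReal (2 * fbmKernelPrimitive H T) * ∫⁻ u in Set.Icc 0 t, ‖g u‖ₑ <
      ENNReal.ofReal δ) :
    ∫⁻ ω, ENNReal.ofReal (Real.exp (b * X ω ^ 2)) ∂P ≤ 2 := by
  obtain ⟨σ, h1, h2⟩ := hX.approx
  have hgm : AEMeasurable (fun u => ‖g u‖ₑ) (volume.restrict (Set.Icc 0 t)) :=
    hX.aestronglyMeasurable.enorm
  have hem : ∀ m, AEMeasurable (fun u => ‖g u - (σ m).eval u‖ₑ)
      (volume.restrict (Set.Icc 0 t)) := fun m =>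
    (hX.aestronglyMeasurable.sub (σ m).stronglyMeasurable_eval.aestronglyMeasurable).enorm
  have hEg : kernelEnergy H t (fun u => ‖g u‖ₑ) (fun u => ‖g u‖ₑ) < ENNReal.ofReal δ :=
    (kernelEnergy_le_of_le_one hH ht hgm hg).trans_lt hgδ
  have hmix := tendsto_kernelEnergy_mixed hH hH1 hT ht hem hg h1
  have hev : ∀ᶠ m in atTop, ∫⁻ ω, ‖(σ m).integral w ω‖ₑ ^ 2 ∂P ≤ ENNReal.ofReal δ := by
    have hlim := (((ENNReal.Tendsto.const_mul hmix
      (Or.inr (ENNReal.ofNat_ne_top : (2 : ℝ≥0∞) ≠ ⊤))).const_add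
      (kernelEnergy H t (fun u => ‖g u‖ₑ) (fun u => ‖g u‖ₑ))).add h1)
    rw [mul_zero, add_zero, add_zero] at hlim
    filter_upwards [hlim.eventually_lt_const hEg] with m hm
    refine (hw.lintegral_stepIntegral_sq_le hH ht (σ m)).trans (le_trans ?_ hm.le)
    refine le_trans ?_ (kernelEnergy_add_self hgm (hem m)).le
    have : ∀ u, ‖(σ m).eval u‖ₑ ≤
        ((fun u => ‖g u‖ₑ) + fun u => ‖g u - (σ m).eval u‖ₑ) u := fun u =>
      calc ‖(σ m).eval u‖ₑ = ‖g u - (g u - (σ m).eval u)‖ₑ := by rw [sub_sub_cancel]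
        _ ≤ _ := enorm_sub_le
    exact kernelEnergy_mono this this
  have hSm : ∀ m, AEStronglyMeasurable ((σ m).integral w) P := fun m =>
    (hw.memLp_stepIntegral ht (σ m)).aestronglyMeasurable
  have hmeas : TendstoInMeasure P (fun m => (σ m).integral w) atTop X := by
    refine tendstoInMeasure_of_tendsto_eLpNorm two_ne_zero hSm hX.memLp.aestronglyMeasurable ?_
    refine h2.congr fun m => ?_
    exact eLpNorm_sub_comm _ _ _ _
  obtain ⟨ns, hns, hae⟩ := hmeas.exists_seq_tendsto_ae
  have hfatou := lintegral_liminf_le' (μ := P) (u := atTop)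
    (f := fun i ω => ENNReal.ofReal (Real.exp (b * (σ (ns i)).integral w ω ^ 2)))
    (fun i => by
      have := (hSm (ns i)).aemeasurable
      fun_prop)
  refine le_trans (lintegral_mono_ae ?_) (hfatou.trans ?_)
  · filter_upwards [hae] with ω hω
    refine (Tendsto.liminf_eq ?_).ge
    exact (ENNReal.continuous_ofReal.tendsto _).comp
      ((Real.continuous_exp.tendsto _).comp ((hω.pow 2).const_mul b))
  · refine liminf_le_of_frequently_le' (Eventually.frequently ?_)
    filter_upwards [hns.tendsto_atTop.eventually hev] with i hi
    exact lintegral_exp_sq_le_of_hasGaussianLaw (hw.hasGaussianLaw_stepIntegral ht _)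
      (hw.integral_stepIntegral ht _) hb hδ hi hbδ

end Wiener

/-! ### Existence of the Wiener integral of a continuously differentiable function -/

section Existence

variable {Ω : Type*} [MeasurableSpace Ω] {P : Measure Ω} {H T : ℝ} {w : ℝ → Ω → ℝ}

theorem measurable_comp_nat {G : ℕ → Ω → ℝ} (hG : ∀ n, Measurable (G n)) {N : ℝ → ℕ}
    (hN : Measurable N) : Measurable fun p : ℝ × Ω => G (N p.1) p.2 := by
  have h1 : Measurable fun p : ℕ × Ω => G p.1 p.2 := measurable_from_prod_countable_right hG
  have h2 : Measurable fun p : ℝ × Ω => (N p.1, p.2) := (hN.comp measurable_fst).prodMk measurable_snd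
  exact h1.comp h2

/-- A process with almost surely continuous paths is jointly measurable, as the limit of its
discretisations in time. -/
theorem aestronglyMeasurable_of_continuous_paths [SFinite P] (hT : 0 ≤ T) {Y : ℝ → Ω → ℝ}
    (hY : ∀ t ∈ Set.Icc 0 T, AEMeasurable (Y t) P)
    (hc : ∀ᵐ ω ∂P, ContinuousOn (fun t => Y t ω) (Set.Icc 0 T)) :
    AEStronglyMeasurable (fun p : ℝ × Ω => Y p.1 p.2) ((volume.restrict (Set.Icc 0 T)).prod P) := by
  -- The grid points `n / (m + 1)`, truncated at `T` so that they stay in `[0,T]`.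
  set q : ℕ → ℕ → ℝ := fun m n => min T (n / ((m : ℝ) + 1)) with hq
  have hqm : ∀ m n, q m n ∈ Set.Icc 0 T := fun m n =>
    ⟨le_min hT (by positivity), min_le_left _ _⟩
  set G : ℕ → ℕ → Ω → ℝ := fun m n => (hY (q m n) (hqm m n)).mk _ with hG
  set N : ℕ → ℝ → ℕ := fun m s => ⌊s * ((m : ℝ) + 1)⌋₊ with hN
  have hmeas : ∀ m, Measurable fun p : ℝ × Ω => G m (N m p.1) p.2 := by
    intro m
    exact measurable_comp_nat (fun n => (hY (q m n) (hqm m n)).measurable_mk)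
      (Nat.measurable_floor.comp (measurable_id.mul_const _))
  refine aestronglyMeasurable_of_tendsto_ae atTop
    (f := fun m (p : ℝ × Ω) => G m (N m p.1) p.2) (fun m => (hmeas m).aestronglyMeasurable) ?_
  have hGY : ∀ᵐ ω ∂P, ∀ m n, G m n ω = Y (q m n) ω :=
    ae_all_iff.2 fun m => ae_all_iff.2 fun n => (hY (q m n) (hqm m n)).ae_eq_mk.symm
  have h1 : ∀ᵐ p : ℝ × Ω ∂((volume.restrict (Set.Icc 0 T)).prod P), p.1 ∈ Set.Icc 0 T :=
    Measure.quasiMeasurePreserving_fst.ae (ae_restrict_mem measurableSet_Icc)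
  have h2 := (Measure.quasiMeasurePreserving_snd (μ := volume.restrict (Set.Icc 0 T))).ae
    (hGY.and hc)
  filter_upwards [h1, h2] with p hp1 hp2
  simp only [hp2.1]
  have hlim : Tendsto (fun m => q m (N m p.1)) atTop (𝓝 p.1) := by
    have h3 : Tendsto (fun m : ℕ => (⌊p.1 * ((m : ℝ) + 1)⌋₊ : ℝ) / ((m : ℝ) + 1)) atTop (𝓝 p.1) :=
      (tendsto_nat_floor_mul_div_atTop hp1.1).comp
        (tendsto_atTop_add_const_right _ 1 tendsto_natCast_atTop_atTop)
    have h4 := (tendsto_const_nhds (x := T)).min h3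
    rwa [min_eq_right hp1.2] at h4
  exact (hp2.2 p.1 hp1).tendsto.comp
    (tendsto_nhdsWithin_of_tendsto_nhds_of_eventually_within _ hlim
      (Eventually.of_forall fun m => hqm m _))

theorem sq_lintegral_le {α : Type*} [MeasurableSpace α] {μ : Measure α} {f : α → ℝ≥0∞}
    (hf : AEMeasurable f μ) : (∫⁻ x, f x ∂μ) ^ 2 ≤ μ Set.univ * ∫⁻ x, f x ^ 2 ∂μ := by
  have h := ENNReal.lintegral_mul_le_Lp_mul_Lq μ Real.HolderConjugate.two_two
    (aemeasurable_const (b := (1 : ℝ≥0∞))) hf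
  simp only [Pi.mul_apply, one_mul, ENNReal.one_rpow, lintegral_const] at h
  refine (pow_le_pow_left' h 2).trans_eq ?_
  rw [mul_pow, ← ENNReal.rpow_mul_natCast, ← ENNReal.rpow_mul_natCast]
  simp

/-- Minkowski's inequality for an integral over a bounded interval, with a uniform bound on the
second moments of the integrand. -/
theorem eLpNorm_intervalIntegral_le [SFinite P] {a b : ℝ} (hab : a ≤ b) {h : ℝ → Ω → ℝ}
    (hh : AEStronglyMeasurable (fun p : ℝ × Ω => h p.1 p.2)
      ((volume.restrict (Set.Ioc a b)).prod P)) {K : ℝ≥0∞}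
    (hK : ∀ s ∈ Set.Ioc a b, ∫⁻ ω, ‖h s ω‖ₑ ^ 2 ∂P ≤ K ^ 2) :
    eLpNorm (fun ω => ∫ s in a..b, h s ω) 2 P ≤ ENNReal.ofReal (b - a) * K := by
  rw [← ENNReal.pow_le_pow_left_iff two_ne_zero, eLpNorm_two_sq]
  have hsec : ∀ᵐ ω ∂P, AEStronglyMeasurable (fun s => h s ω) (volume.restrict (Set.Ioc a b)) :=
    hh.prod_swap.prodMk_left
  have hvol : (volume.restrict (Set.Ioc a b)) Set.univ = ENNReal.ofReal (b - a) := by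
    rw [Measure.restrict_apply_univ, Real.volume_Ioc]
  calc ∫⁻ ω, ‖∫ s in a..b, h s ω‖ₑ ^ 2 ∂P
      ≤ ∫⁻ ω, ENNReal.ofReal (b - a) * (∫⁻ s in Set.Ioc a b, ‖h s ω‖ₑ ^ 2) ∂P := by
        refine lintegral_mono_ae ?_
        filter_upwards [hsec] with ω hω
        rw [intervalIntegral.integral_of_le hab, ← hvol]
        exact (pow_le_pow_left' (enorm_integral_le_lintegral_enorm _) 2).trans
          (sq_lintegral_le hω.enorm)
    _ = ENNReal.ofReal (b - a) * ∫⁻ s in Set.Ioc a b, ∫⁻ ω, ‖h s ω‖ₑ ^ 2 ∂P := by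
        rw [lintegral_const_mul' _ _ ENNReal.ofReal_ne_top, lintegral_lintegral_swap]
        exact (hh.prod_swap.enorm.pow_const 2)
    _ ≤ ENNReal.ofReal (b - a) * ∫⁻ s in Set.Ioc a b, K ^ 2 := by
        gcongr ENNReal.ofReal (b - a) * ?_
        exact setLIntegral_mono' measurableSet_Ioc hK
    _ = _ := by
        rw [lintegral_const, hvol]
        ring

theorem IsFBM.lintegral_increment_sq [IsProbabilityMeasure P] (hw : IsFBM H T w P) (hH : 1 / 2 < H)
    {a b : ℝ} (ha : a ∈ Set.Icc 0 T) (hb : b ∈ Set.Icc 0 T) :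
    ∫⁻ ω, ‖w b ω - w a ω‖ₑ ^ 2 ∂P = ENNReal.ofReal (|b - a| ^ H) ^ 2 := by
  have h1 := hw.integral_mul_increments ha hb ha hb
  have hm := (hw.memLp hb).sub (hw.memLp ha)
  have hi : Integrable (fun ω => (w b ω - w a ω) * (w b ω - w a ω)) P := hm.integrable_mul hm
  have h2 : ∫⁻ ω, ‖w b ω - w a ω‖ₑ ^ 2 ∂P =
      ENNReal.ofReal (∫ ω, (w b ω - w a ω) * (w b ω - w a ω) ∂P) := by
    rw [ofReal_integral_eq_lintegral_ofReal hi
      (ae_of_all _ fun ω => mul_self_nonneg _)]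
    refine lintegral_congr fun ω => ?_
    rw [← pow_two, ← ofReal_norm, ← ENNReal.ofReal_pow (norm_nonneg _), Real.norm_eq_abs, sq_abs]
  rw [h2, h1, ← ENNReal.ofReal_pow (by positivity), ← Real.rpow_mul_natCast (abs_nonneg _)]
  congr 1
  rw [sub_self, sub_self, abs_zero, Real.zero_rpow (by linarith), abs_sub_comm a b]
  push_cast
  rw [mul_comm H 2]
  ring

/-- The equidistant step function with `m + 1` steps, taking the value of `g` at the left
endpoints. -/
noncomputable def leftStepFun {t : ℝ} (ht : 0 ≤ t) (g : ℝ → ℝ) (m : ℕ) : StepFun ℝ t where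
  n := m + 1
  τ := fun i => t * (min i (m + 1) : ℕ) / ((m : ℝ) + 1)
  mono := by
    intro i j hij
    dsimp only
    gcongr
  first := by simp
  last := by
    simp only [min_self]
    push_cast
    field_simp
  c := fun i => g (t * (min i (m + 1) : ℕ) / ((m : ℝ) + 1))

theorem leftStepFun_step {t : ℝ} (ht : 0 ≤ t) (g : ℝ → ℝ) (m : ℕ) {i : ℕ}
    (hi : i < m + 1) :
    (leftStepFun ht g m).τ (i + 1) - (leftStepFun ht g m).τ i = t / ((m : ℝ) + 1) := by
  simp only [leftStepFun]
  rw [min_eq_left (by omega), min_eq_left (by omega)]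
  push_cast
  ring

theorem tendsto_mesh (t : ℝ) : Tendsto (fun m : ℕ => t / ((m : ℝ) + 1)) atTop (𝓝 0) :=
  tendsto_const_nhds.div_atTop (tendsto_atTop_add_const_right _ 1 tendsto_natCast_atTop_atTop)

variable {t : ℝ} {g g' : ℝ → ℝ} {L : ℝ}

/-- A step function with steps of length `t / (m + 1)` approximates `g` to within the Lipschitz
constant times that length. The point `0` belongs to no step and is excluded. -/
theorem leftStepFun_error (ht0 : 0 ≤ t) (hg : ∀ s, HasDerivAt g (g' s) s)
    (hL : ∀ s ∈ Set.Icc 0 t, |g' s| ≤ L) (m : ℕ) {u : ℝ} (hu : u ∈ Set.Ioc 0 t) :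
    |g u - (leftStepFun ht0 g m).eval u| ≤ L * (t / ((m : ℝ) + 1)) := by
  obtain ⟨i, hi, hui⟩ := (leftStepFun ht0 g m).exists_mem_Ioc hu
  have hL0 : 0 ≤ L := (abs_nonneg _).trans (hL 0 (Set.left_mem_Icc.2 ht0))
  rw [StepFun.eval_eq_of_mem _ hi hui]
  have hτ := (leftStepFun ht0 g m).τ_mem hi.le
  have h1 := (convex_Icc 0 t).norm_image_sub_le_of_norm_hasDerivWithin_le (C := L)
    (fun s _ => (hg s).hasDerivWithinAt) (fun s hs => hL s hs) hτ (Set.Ioc_subset_Icc_self hu)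
  refine h1.trans (mul_le_mul_of_nonneg_left ?_ hL0)
  rw [Real.norm_of_nonneg (by linarith [hui.1]), ← leftStepFun_step ht0 g m hi]
  linarith [hui.2]

theorem tendsto_energy_leftStepFun (hH : 1 / 2 < H) (ht0 : 0 ≤ t)
    (hg : ∀ s, HasDerivAt g (g' s) s) (hL : ∀ s ∈ Set.Icc 0 t, |g' s| ≤ L) :
    Tendsto (fun m => ∫⁻ u in Set.Icc 0 t, ∫⁻ v in Set.Icc 0 t,
      ‖g u - (leftStepFun ht0 g m).eval u‖ₑ * ‖g v - (leftStepFun ht0 g m).eval v‖ₑ *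
        ENNReal.ofReal (fbmKernel H (u - v))) atTop (𝓝 0) := by
  set δ : ℕ → ℝ≥0∞ := fun m => ENNReal.ofReal (L * (t / ((m : ℝ) + 1))) with hδ
  have hδ0 : Tendsto δ atTop (𝓝 0) := by
    have := (ENNReal.continuous_ofReal.tendsto _).comp ((tendsto_mesh t).const_mul L)
    rw [mul_zero, ENNReal.ofReal_zero] at this
    exact this
  set C : ℝ≥0∞ := ENNReal.ofReal (2 * fbmKernelPrimitive H t) with hC
  have hlim : Tendsto (fun m => C * ENNReal.ofReal t * δ m ^ 2) atTop (𝓝 0) := by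
    have := ENNReal.Tendsto.const_mul (ENNReal.Tendsto.pow (n := 2) hδ0)
      (Or.inr (ENNReal.mul_ne_top ENNReal.ofReal_ne_top ENNReal.ofReal_ne_top :
        C * ENNReal.ofReal t ≠ ⊤))
    simpa using this
  refine tendsto_of_tendsto_of_tendsto_of_le_of_le tendsto_const_nhds hlim
    (fun _ => zero_le) fun m => ?_
  have herr : ∀ᵐ u ∂(volume.restrict (Set.Icc 0 t)),
      ‖g u - (leftStepFun ht0 g m).eval u‖ₑ ≤ δ m := by
    rw [← restrict_Ioc_eq_restrict_Icc]
    filter_upwards [ae_restrict_mem measurableSet_Ioc] with u hu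
    rw [← ofReal_norm]
    exact ENNReal.ofReal_le_ofReal (leftStepFun_error ht0 hg hL m hu)
  calc _ ≤ ∫⁻ u in Set.Icc 0 t, δ m ^ 2 * C := by
        refine lintegral_mono_ae ?_
        filter_upwards [herr, ae_restrict_mem measurableSet_Icc] with u hu huI
        calc _ ≤ ∫⁻ v in Set.Icc 0 t, δ m ^ 2 * ENNReal.ofReal (fbmKernel H (u - v)) := by
              refine lintegral_mono_ae ?_
              filter_upwards [herr] with v hv
              rw [pow_two]
              gcongr
          _ = δ m ^ 2 * ∫⁻ v in Set.Icc 0 t, ENNReal.ofReal (fbmKernel H (u - v)) :=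
              lintegral_const_mul _ (measurable_ofReal_fbmKernel_sub_right H u)
          _ ≤ _ := by
              gcongr
              exact lintegral_Icc_fbmKernel_le hH le_rfl huI
    _ = _ := by
        rw [setLIntegral_const, Real.volume_Icc, sub_zero]
        ring

/-- The right-hand side of the integration by parts formula
`∫₀ᵗ g dw = g(t) w(t) - g(0) w(0) - ∫₀ᵗ g'(s) w(s) ds`. -/
noncomputable def byParts {Ω' : Type*} (g g' : ℝ → ℝ) (w : ℝ → Ω' → ℝ) (t : ℝ) (ω : Ω') : ℝ :=
  g t * w t ω - g 0 * w 0 ω - ∫ s in (0 : ℝ)..t, g' s * w s ω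

/-- Summation by parts: the error of the Riemann sum is a sum of integrals of increments of `w`
over the steps of the partition. -/
theorem byParts_sub_leftStepFun {Ω' : Type*} {w : ℝ → Ω' → ℝ} (ht0 : 0 ≤ t)
    (hg : ∀ s, HasDerivAt g (g' s) s) (hg' : Continuous g') (m : ℕ) {ω : Ω'}
    (hω : ContinuousOn (fun s => w s ω) (Set.Icc 0 t)) :
    byParts g g' w t ω - (leftStepFun ht0 g m).integral w ω =
      ∑ i ∈ Finset.range (m + 1),
        ∫ s in (leftStepFun ht0 g m).τ i..(leftStepFun ht0 g m).τ (i + 1),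
          g' s * (w ((leftStepFun ht0 g m).τ (i + 1)) ω - w s ω) := by
  set σ := leftStepFun ht0 g m with hσ
  have hn : σ.n = m + 1 := rfl
  have hc : ∀ i, σ.c i = g (σ.τ i) := fun i => rfl
  have hint : ∀ i < m + 1, IntervalIntegrable (fun s => g' s * w s ω) volume
      (σ.τ i) (σ.τ (i + 1)) := by
    intro i hi
    refine (hg'.continuousOn.mul (hω.mono ?_)).intervalIntegrable
    rw [Set.uIcc_of_le (σ.mono i.le_succ)]
    exact Set.Icc_subset_Icc (σ.τ_mem (hn ▸ hi.le)).1 (σ.τ_mem (hn ▸ hi : i + 1 ≤ σ.n)).2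
  have h1 : ∫ s in (0 : ℝ)..t, g' s * w s ω =
      ∑ i ∈ Finset.range (m + 1), ∫ s in σ.τ i..σ.τ (i + 1), g' s * w s ω := by
    rw [intervalIntegral.sum_integral_adjacent_intervals hint, σ.first, ← hn, σ.last]
  have h2 : g t * w t ω - g 0 * w 0 ω = ∑ i ∈ Finset.range (m + 1),
      (g (σ.τ (i + 1)) * w (σ.τ (i + 1)) ω - g (σ.τ i) * w (σ.τ i) ω) := by
    rw [Finset.sum_range_sub fun i => g (σ.τ i) * w (σ.τ i) ω, σ.first, ← hn, σ.last]
  rw [byParts, h1, h2, StepFun.integral, hn, ← Finset.sum_sub_distrib, ← Finset.sum_sub_distrib]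
  refine Finset.sum_congr rfl fun i hi => ?_
  have h3 : ∫ s in σ.τ i..σ.τ (i + 1), g' s * (w (σ.τ (i + 1)) ω - w s ω) =
      (g (σ.τ (i + 1)) - g (σ.τ i)) * w (σ.τ (i + 1)) ω
        - ∫ s in σ.τ i..σ.τ (i + 1), g' s * w s ω := by
    simp only [mul_sub]
    rw [intervalIntegral.integral_sub ((hg'.intervalIntegrable _ _).mul_const _)
      (hint i (Finset.mem_range.1 hi)), intervalIntegral.integral_mul_const,
      intervalIntegral.integral_eq_sub_of_hasDerivAt (fun s _ => hg s)
        (hg'.intervalIntegrable _ _)]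
  rw [h3, hc, smul_eq_mul]
  ring

theorem IsFBM.aestronglyMeasurable_path [IsProbabilityMeasure P] (hw : IsFBM H T w P)
    (hT : 0 ≤ T) : AEStronglyMeasurable (fun p : ℝ × Ω => w p.1 p.2)
      ((volume.restrict (Set.Icc 0 T)).prod P) :=
  aestronglyMeasurable_of_continuous_paths hT
    (fun _ ht => (hw.memLp ht).aestronglyMeasurable.aemeasurable) hw.continuous_paths

theorem IsFBM.aestronglyMeasurable_byParts [IsProbabilityMeasure P] (hw : IsFBM H T w P)
    (ht : t ∈ Set.Icc 0 T) (hg' : Continuous g') : AEStronglyMeasurable (byParts g g' w t) P := by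
  have hT : (0 : ℝ) ∈ Set.Icc 0 T := Set.left_mem_Icc.2 (ht.1.trans ht.2)
  refine (((hw.memLp ht).aestronglyMeasurable.const_mul _).sub
    ((hw.memLp hT).aestronglyMeasurable.const_mul _)).sub ?_
  simp only [intervalIntegral.integral_of_le ht.1]
  have h1 := (hw.aestronglyMeasurable_path hT.2).mono_measure
    (Measure.prod_mono (Measure.restrict_mono_set volume
      (Set.Ioc_subset_Icc_self.trans (Set.Icc_subset_Icc_right ht.2) : Set.Ioc 0 t ⊆ _)) (le_refl P))
  have h2 : AEStronglyMeasurable (fun p : ℝ × Ω => g' p.1 * w p.1 p.2)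
      ((volume.restrict (Set.Ioc 0 t)).prod P) :=
    hg'.aestronglyMeasurable.comp_fst.mul h1
  exact h2.prod_swap.integral_prod_right'

theorem IsFBM.eLpNorm_byParts_sub_le [IsProbabilityMeasure P] (hw : IsFBM H T w P)
    (hH : 1 / 2 < H) (ht : t ∈ Set.Icc 0 T) (hg : ∀ s, HasDerivAt g (g' s) s)
    (hg' : Continuous g') (hL : ∀ s ∈ Set.Icc 0 t, |g' s| ≤ L) (m : ℕ) :
    eLpNorm (fun ω => byParts g g' w t ω - (leftStepFun ht.1 g m).integral w ω) 2 P ≤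
      ENNReal.ofReal t * ENNReal.ofReal (L * (t / ((m : ℝ) + 1)) ^ H) := by
  set σ := leftStepFun ht.1 g m with hσ
  have hL0 : 0 ≤ L := (abs_nonneg _).trans (hL 0 (Set.left_mem_Icc.2 ht.1))
  have hT : Set.Icc 0 t ⊆ Set.Icc 0 T := Set.Icc_subset_Icc_right ht.2
  have hn : σ.n = m + 1 := rfl
  have hae : (fun ω => byParts g g' w t ω - σ.integral w ω) =ᵐ[P]
      ∑ i ∈ Finset.range (m + 1), fun ω => ∫ s in σ.τ i..σ.τ (i + 1),
          g' s * (w (σ.τ (i + 1)) ω - w s ω) := by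
    filter_upwards [hw.continuous_paths] with ω hω
    rw [Finset.sum_apply]
    exact byParts_sub_leftStepFun ht.1 hg hg' m (hω.mono hT)
  have hmem : ∀ i ∈ Finset.range (m + 1), σ.τ i ∈ Set.Icc 0 t ∧ σ.τ (i + 1) ∈ Set.Icc 0 t := by
    intro i hi
    have hi := Finset.mem_range.1 hi
    exact ⟨σ.τ_mem (hn ▸ hi.le), σ.τ_mem (hn ▸ hi : i + 1 ≤ σ.n)⟩
  have hjoint : ∀ i ∈ Finset.range (m + 1), AEStronglyMeasurable
      (fun p : ℝ × Ω => g' p.1 * (w (σ.τ (i + 1)) p.2 - w p.1 p.2))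
      ((volume.restrict (Set.Ioc (σ.τ i) (σ.τ (i + 1)))).prod P) := by
    intro i hi
    have h1 := (hw.aestronglyMeasurable_path (ht.1.trans ht.2)).mono_measure
      (Measure.prod_mono (Measure.restrict_mono_set volume
        (Set.Ioc_subset_Icc_self.trans (Set.Icc_subset_Icc (hmem i hi).1.1
          (hT (hmem i hi).2).2) : Set.Ioc (σ.τ i) (σ.τ (i + 1)) ⊆ _)) (le_refl P))
    exact hg'.aestronglyMeasurable.comp_fst.mul
      ((hw.memLp (hT (hmem i hi).2)).aestronglyMeasurable.comp_snd.sub h1)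
  rw [eLpNorm_congr_ae hae]
  refine (eLpNorm_sum_le (fun i hi => ?_) one_le_two).trans ?_
  · simp only [intervalIntegral.integral_of_le (σ.mono i.le_succ)]
    exact (hjoint i hi).prod_swap.integral_prod_right'
  · have hterm : ∀ i ∈ Finset.range (m + 1),
        eLpNorm (fun ω => ∫ s in σ.τ i..σ.τ (i + 1), g' s * (w (σ.τ (i + 1)) ω - w s ω)) 2 P ≤
          ENNReal.ofReal (σ.τ (i + 1) - σ.τ i) *
            ENNReal.ofReal (L * (t / ((m : ℝ) + 1)) ^ H) := by
      intro i hi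
      refine eLpNorm_intervalIntegral_le (σ.mono i.le_succ) (hjoint i hi) fun s hs => ?_
      have hs' : s ∈ Set.Icc 0 t :=
        ⟨(hmem i hi).1.1.trans hs.1.le, hs.2.trans (hmem i hi).2.2⟩
      simp only [enorm_mul, mul_pow]
      rw [lintegral_const_mul' _ _ (by finiteness),
        hw.lintegral_increment_sq hH (hT hs') (hT (hmem i hi).2), ENNReal.ofReal_mul hL0, mul_pow]
      have hgs : ‖g' s‖ₑ ≤ ENNReal.ofReal L := by
        rw [← ofReal_norm]
        exact ENNReal.ofReal_le_ofReal (hL s hs')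
      have hds : |σ.τ (i + 1) - s| ≤ t / ((m : ℝ) + 1) := by
        rw [← leftStepFun_step ht.1 g m (Finset.mem_range.1 hi),
          abs_of_nonneg (by linarith [hs.2])]
        linarith [hs.1]
      gcongr
    refine (Finset.sum_le_sum hterm).trans_eq ?_
    rw [← Finset.sum_mul, ← ENNReal.ofReal_sum_of_nonneg fun i _ =>
      sub_nonneg.2 (σ.mono i.le_succ), Finset.sum_range_sub, σ.first, ← hn, σ.last, sub_zero]

/-- Integration by parts gives the Wiener integral of a continuously differentiable function. -/
theorem IsFBM.hasWienerIntegral_byParts [IsProbabilityMeasure P] (hw : IsFBM H T w P)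
    (hH : 1 / 2 < H) (ht : t ∈ Set.Icc 0 T) (hg : ∀ s, HasDerivAt g (g' s) s)
    (hg' : Continuous g') : HasWienerIntegral H P w t g (byParts g g' w t) := by
  obtain ⟨L, hL⟩ := isCompact_Icc.exists_bound_of_continuousOn (hg'.continuousOn (s := Set.Icc 0 t))
  have hbound := hw.eLpNorm_byParts_sub_le hH ht hg hg' hL
  refine ⟨?_, ⟨hw.aestronglyMeasurable_byParts ht hg', ?_⟩, fun m => leftStepFun ht.1 g m,
    tendsto_energy_leftStepFun hH ht.1 hg hL, ?_⟩
  · exact Continuous.aestronglyMeasurable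
      (continuous_iff_continuousAt.2 fun s => (hg s).continuousAt)
  · have hS := hw.memLp_stepIntegral ht.2 (leftStepFun ht.1 g 0)
    have h1 := eLpNorm_add_le ((hw.aestronglyMeasurable_byParts (g := g) ht hg').sub
      hS.aestronglyMeasurable) hS.aestronglyMeasurable one_le_two
    rw [sub_add_cancel] at h1
    refine h1.trans_lt (ENNReal.add_lt_top.2 ⟨(hbound 0).trans_lt ?_, hS.eLpNorm_lt_top⟩)
    exact ENNReal.mul_lt_top ENNReal.ofReal_lt_top ENNReal.ofReal_lt_top
  · refine tendsto_of_tendsto_of_tendsto_of_le_of_le tendsto_const_nhds ?_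
      (fun _ => zero_le) hbound
    have h1 : Tendsto (fun m : ℕ => L * (t / ((m : ℝ) + 1)) ^ H) atTop (𝓝 0) := by
      have h2 := ((tendsto_mesh t).rpow_const (p := H) (Or.inr (by linarith))).const_mul L
      rwa [Real.zero_rpow (by linarith), mul_zero] at h2
    have h3 := ENNReal.Tendsto.const_mul ((ENNReal.continuous_ofReal.tendsto _).comp h1)
      (Or.inr (ENNReal.ofReal_ne_top : ENNReal.ofReal t ≠ ⊤))
    simpa using h3

end Existence

/-! ### The Galerkin semigroup in the eigenbasis -/

theorem integral_cos_int_mul_pi (m : ℤ) :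
    ∫ x in (0 : ℝ)..1, Real.cos (m * Real.pi * x) = if m = 0 then 1 else 0 := by
  split_ifs with hm
  · simp [hm]
  · have h0 : (m : ℝ) * Real.pi ≠ 0 := mul_ne_zero (Int.cast_ne_zero.2 hm) Real.pi_ne_zero
    rw [intervalIntegral.integral_comp_mul_left _ h0, integral_cos, mul_one, mul_zero,
      Real.sin_int_mul_pi, Real.sin_zero, sub_zero, smul_zero]

theorem coeFn_eigenfunction (k : ℕ) : (eigenfunction k : ℝ → ℝ) =ᵐ[leb01]
    fun x => √2 * Real.sin (((k : ℝ) + 1) * Real.pi * x) :=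
  (memLp_sin k).coeFn_toLp

theorem inner_eigenfunction (j k : ℕ) :
    inner ℝ (eigenfunction j) (eigenfunction k) = if j = k then (1 : ℝ) else 0 := by
  have h1 : inner ℝ (eigenfunction j) (eigenfunction k) =
      ∫ x in (0 : ℝ)..1, (Real.cos (((j - k : ℤ) : ℝ) * Real.pi * x)
        - Real.cos (((j + k + 2 : ℤ) : ℝ) * Real.pi * x)) := by
    rw [L2.inner_def, intervalIntegral.integral_of_le zero_le_one, integral_Ioc_eq_integral_Ioo]
    refine integral_congr_ae ?_
    filter_upwards [coeFn_eigenfunction j, coeFn_eigenfunction k] with x hj hk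
    rw [hj, hk, real_inner_eq_re_inner]
    have h2 := Real.cos_sub (((j : ℝ) + 1) * Real.pi * x) (((k : ℝ) + 1) * Real.pi * x)
    have h3 := Real.cos_add (((j : ℝ) + 1) * Real.pi * x) (((k : ℝ) + 1) * Real.pi * x)
    have h4 : √2 * √2 = (2 : ℝ) := Real.mul_self_sqrt zero_le_two
    push_cast
    rw [show ((j : ℝ) - k) * Real.pi * x = ((j : ℝ) + 1) * Real.pi * x - ((k : ℝ) + 1) * Real.pi * x
      by ring, show ((j : ℝ) + k + 2) * Real.pi * x =
        ((j : ℝ) + 1) * Real.pi * x + ((k : ℝ) + 1) * Real.pi * x by ring, h2, h3]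
    simp only [RCLike.inner_apply, conj_trivial, RCLike.re_to_real]
    linear_combination Real.sin (((j : ℝ) + 1) * Real.pi * x) *
      Real.sin (((k : ℝ) + 1) * Real.pi * x) * h4
  have hne : (j + k + 2 : ℤ) ≠ 0 := by positivity
  rw [h1, intervalIntegral.integral_sub
    (Continuous.intervalIntegrable (by fun_prop) _ _)
    (Continuous.intervalIntegrable (by fun_prop) _ _), integral_cos_int_mul_pi,
    integral_cos_int_mul_pi, if_neg hne, sub_zero]
  simp only [sub_eq_zero, Nat.cast_inj]

theorem inner_eigenfunction_sum {N j : ℕ} (hj : j < N) (a : ℕ → ℝ) :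
    inner ℝ (eigenfunction j) (∑ k ∈ Finset.range N, a k • eigenfunction k) = a j := by
  rw [inner_sum, Finset.sum_eq_single_of_mem j (Finset.mem_range.2 hj), real_inner_smul_right,
    inner_eigenfunction, if_pos rfl, mul_one]
  intro k _ hk
  rw [real_inner_smul_right, inner_eigenfunction, if_neg hk.symm, mul_zero]

theorem eigenfunction_mem_galerkinSpace {N k : ℕ} (hk : k < N) :
    eigenfunction k ∈ galerkinSpace N :=
  Submodule.subset_span ⟨k, hk, rfl⟩

theorem galerkinProj_eigenfunction_of_lt {N k : ℕ} (hk : k < N) :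
    galerkinProj N (eigenfunction k) = ⟨eigenfunction k, eigenfunction_mem_galerkinSpace hk⟩ :=
  Submodule.orthogonalProjectionOnto_mem_subspace_eq_self
    (⟨eigenfunction k, eigenfunction_mem_galerkinSpace hk⟩ : galerkinSpace N)

theorem galerkinProj_eigenfunction_of_le {N k : ℕ} (hk : N ≤ k) :
    galerkinProj N (eigenfunction k) = 0 := by
  refine Submodule.orthogonalProjectionOnto_eq_zero_iff.2 ?_
  rw [Submodule.mem_orthogonal]
  intro u hu
  refine Submodule.span_induction (p := fun u _ => inner ℝ u (eigenfunction k) = 0) ?_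
    (inner_zero_left _) (fun x y _ _ hx hy => by rw [inner_add_left, hx, hy, add_zero])
    (fun c x _ hx => by rw [real_inner_smul_left, hx, mul_zero]) hu
  rintro _ ⟨j, hj, rfl⟩
  rw [inner_eigenfunction, if_neg]
  have : j < N := hj
  omega

theorem galerkinA_eigenfunction {N k : ℕ} (hk : k < N) :
    galerkinA N ⟨eigenfunction k, eigenfunction_mem_galerkinSpace hk⟩ =
      eigenvalue k • ⟨eigenfunction k, eigenfunction_mem_galerkinSpace hk⟩ := by
  obtain ⟨h1, h2⟩ := negLaplacian_eigenfunction k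
  change galerkinProj N (negLaplacian ⟨eigenfunction k, h1⟩) = _
  rw [h2, map_smul, galerkinProj_eigenfunction_of_lt hk]

theorem exp_apply_of_eigenvector {V : Type*} [NormedAddCommGroup V] [NormedSpace ℝ V]
    [CompleteSpace V] (B : V →L[ℝ] V) {v : V} {μ : ℝ} (hv : B v = μ • v) :
    NormedSpace.exp B v = Real.exp μ • v := by
  have hpow : ∀ n : ℕ, (B ^ n) v = μ ^ n • v := by
    intro n
    induction n with
    | zero => simp
    | succ n ih =>
      rw [pow_succ]
      change (B ^ n) (B v) = _
      rw [hv, map_smul, ih, smul_smul, pow_succ, mul_comm]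
  have h1 := (NormedSpace.exp_series_hasSum_exp' (𝕂 := ℝ) B).mapL (ContinuousLinearMap.apply ℝ V v)
  have h2 := (NormedSpace.exp_series_hasSum_exp' (𝕂 := ℝ) μ).smul_const v
  rw [← Real.exp_eq_exp_ℝ] at h2
  refine h1.unique (h2.congr_fun fun n => ?_)
  simp [hpow, smul_smul]

theorem galerkinSemigroup_eigenfunction {N k : ℕ} (hk : k < N) (η t : ℝ) :
    galerkinSemigroup N η t ⟨eigenfunction k, eigenfunction_mem_galerkinSpace hk⟩ =
      Real.exp (-(t * (eigenvalue k + η))) •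
        ⟨eigenfunction k, eigenfunction_mem_galerkinSpace hk⟩ := by
  refine exp_apply_of_eigenvector _ ?_
  change -(t • (galerkinA N _ + η • (⟨eigenfunction k, _⟩ : galerkinSpace N))) = _
  rw [galerkinA_eigenfunction hk, ← add_smul, smul_smul, neg_smul]

/-- The integrand of the stochastic convolution, applied to an eigenfunction. -/
theorem galerkinIntegrand_eigenfunction (N k : ℕ) (η t : ℝ) :
    ((galerkinSpace N).subtypeL ∘L galerkinSemigroup N η t ∘L galerkinProj N) (eigenfunction k) =
      (if k < N then Real.exp (-(t * (eigenvalue k + η))) else 0) • eigenfunction k := by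
  simp only [ContinuousLinearMap.comp_apply]
  split_ifs with hk
  · rw [galerkinProj_eigenfunction_of_lt hk, galerkinSemigroup_eigenfunction hk, map_smul]
    rfl
  · rw [galerkinProj_eigenfunction_of_le (not_lt.1 hk), map_zero, map_zero, zero_smul]

/-! ### The supremum norm on the Galerkin space -/

theorem eLpNorm_top_sum_eigenfunction_le (a : ℕ → ℝ) (s : Finset ℕ) :
    eLpNorm ((∑ j ∈ s, a j • eigenfunction j : U) : ℝ → ℝ) ∞ leb01 ≤
      ENNReal.ofReal (√2 * ∑ j ∈ s, |a j|) := by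
  classical
  induction s using Finset.induction_on with
  | empty =>
    rw [Finset.sum_empty, eLpNorm_congr_ae (Lp.coeFn_zero ℝ 2 leb01), eLpNorm_zero]
    exact zero_le
  | insert j s hj ih =>
    rw [Finset.sum_insert hj, Finset.sum_insert hj, eLpNorm_congr_ae (Lp.coeFn_add _ _), mul_add,
      ENNReal.ofReal_add (by positivity) (by positivity)]
    refine (eLpNorm_add_le (Lp.aestronglyMeasurable _) (Lp.aestronglyMeasurable _) le_top).trans
      (add_le_add ?_ ih)
    refine (eLpNorm_le_of_ae_bound (C := √2 * |a j|) ?_).trans_eq (by simp)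
    filter_upwards [Lp.coeFn_smul (a j) (eigenfunction j), coeFn_eigenfunction j] with x h1 h2
    rw [h1, Pi.smul_apply, h2, smul_eq_mul, norm_mul, norm_mul, Real.norm_of_nonneg
      (Real.sqrt_nonneg 2), Real.norm_eq_abs, Real.norm_eq_abs, mul_comm |a j|]
    exact mul_le_mul_of_nonneg_right
      (mul_le_of_le_one_right (Real.sqrt_nonneg 2) (Real.abs_sin_le_one _)) (abs_nonneg _)

theorem eLpNorm_top_sq_le (a : ℕ → ℝ) (N : ℕ) :
    eLpNorm ((∑ j ∈ Finset.range N, a j • eigenfunction j : U) : ℝ → ℝ) ∞ leb01 ^ 2 ≤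
      ENNReal.ofReal (2 * N * ∑ j ∈ Finset.range N, a j ^ 2) := by
  refine (pow_le_pow_left' (eLpNorm_top_sum_eigenfunction_le a _) 2).trans ?_
  rw [← ENNReal.ofReal_pow (by positivity)]
  refine ENNReal.ofReal_le_ofReal ?_
  rw [mul_pow, Real.sq_sqrt zero_le_two, mul_assoc]
  refine mul_le_mul_of_nonneg_left ?_ zero_le_two
  have := sq_sum_le_card_mul_sum_sq (s := Finset.range N) (f := fun j => |a j|)
  simpa only [Finset.card_range, sq_abs] using this

/-! ### The stochastic convolution in the eigenbasis -/

section Convolution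

variable {Ω : Type*} [MeasurableSpace Ω] {P : Measure Ω} {H T : ℝ} {w : ℕ → ℝ → Ω → ℝ}

theorem hasDerivAt_exp_decay (t a s : ℝ) :
    HasDerivAt (fun s => Real.exp (-((t - s) * a))) (a * Real.exp (-((t - s) * a))) s := by
  have h : HasDerivAt (fun s => -((t - s) * a)) a s := by
    refine (((hasDerivAt_id s).const_sub t).mul_const a).neg.congr_deriv ?_
    ring
  exact h.exp.congr_deriv (mul_comm _ _)

theorem lintegral_exp_decay_le {a η t : ℝ} (hη : 0 < η) (ha : η ≤ a) (ht : 0 ≤ t) :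
    ∫⁻ s in Set.Icc 0 t, ‖Real.exp (-((t - s) * a))‖ₑ ≤ ENNReal.ofReal (1 / η) := by
  have ha0 : 0 < a := hη.trans_le ha
  have hc : Continuous fun s : ℝ => Real.exp (-((t - s) * a)) := by fun_prop
  have hder : ∀ s, HasDerivAt (fun s => Real.exp (-((t - s) * a)) / a)
      (Real.exp (-((t - s) * a))) s := by
    intro s
    refine ((hasDerivAt_exp_decay t a s).div_const a).congr_deriv ?_
    rw [mul_div_cancel_left₀ _ ha0.ne']
  have h1 : ∀ s : ℝ, ‖Real.exp (-((t - s) * a))‖ₑ = ENNReal.ofReal (Real.exp (-((t - s) * a))) :=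
    fun s => Real.enorm_of_nonneg (Real.exp_pos _).le
  simp only [h1]
  rw [← restrict_Ioc_eq_restrict_Icc, ← ofReal_integral_eq_lintegral_ofReal
    ((intervalIntegrable_iff_integrableOn_Ioc_of_le ht).1 (hc.intervalIntegrable 0 t))
    (ae_of_all _ fun s => (Real.exp_pos _).le), ← intervalIntegral.integral_of_le ht,
    intervalIntegral.integral_eq_sub_of_hasDerivAt (fun s _ => hder s) (hc.intervalIntegrable 0 t)]
  refine ENNReal.ofReal_le_ofReal ?_
  calc _ ≤ Real.exp (-((t - t) * a)) / a := sub_le_self _ (by positivity)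
    _ = 1 / a := by simp
    _ ≤ 1 / η := one_div_le_one_div_of_le hη ha

/-- The stochastic convolution at time `t` is a combination of the first `N` eigenfunctions, whose
coefficients are scalar Wiener integrals of exponentials. -/
theorem IsCylindricalFBM.exists_coefficients [IsProbabilityMeasure P]
    (hw : IsCylindricalFBM H T w P) (hH : 1 / 2 < H) {N : ℕ} {η t : ℝ} (ht : t ≤ T)
    {Y : Ω → U} (hY : HasCylindricalIntegral H P w t
      (fun s => (galerkinSpace N).subtypeL ∘L galerkinSemigroup N η (t - s) ∘L galerkinProj N) Y) :
    ∃ ξ : ℕ → Ω → ℝ,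
      (∀ k < N, HasWienerIntegral H P (w k) t
        (fun s => Real.exp (-((t - s) * (eigenvalue k + η)))) (ξ k)) ∧
      Y =ᵐ[P] fun ω => ∑ k ∈ Finset.range N, ξ k ω • eigenfunction k := by
  obtain ⟨X, hX, hlim⟩ := hY.series
  simp only [galerkinIntegrand_eigenfunction] at hX
  set φ : ℕ → U →L[ℝ] ℝ := fun k => innerSL ℝ (eigenfunction k) with hφ
  have hφk : ∀ k, φ k (eigenfunction k) = 1 := fun k =>
    (inner_eigenfunction k k).trans (if_pos rfl)
  -- The complement of the projection onto `φ k` annihilates the integrand, hence also the integral.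
  have hXk : ∀ k, X k =ᵐ[P] fun ω => φ k (X k ω) • eigenfunction k := by
    intro k
    have h1 := (hX k).map
      (ContinuousLinearMap.id ℝ U - (φ k).smulRight (eigenfunction k))
    have h2 : (fun s => (ContinuousLinearMap.id ℝ U - (φ k).smulRight (eigenfunction k))
        ((if k < N then Real.exp (-((t - s) * (eigenvalue k + η))) else 0) • eigenfunction k)) =
        fun _ => 0 := by
      funext s
      rw [map_smul]
      simp [hφk]
    rw [h2] at h1
    filter_upwards [(hw.isFBM k).wienerIntegral_zero hH ht h1] with ω hω
    exact sub_eq_zero.1 hω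
  have hX0 : ∀ k, N ≤ k → X k =ᵐ[P] 0 := by
    intro k hk
    have h1 := hX k
    simp only [if_neg (not_lt.2 hk), zero_smul] at h1
    exact (hw.isFBM k).wienerIntegral_zero hH ht h1
  refine ⟨fun k ω => φ k (X k ω), fun k hk => ?_, ?_⟩
  · have h1 := (hX k).map (φ k)
    simp only [if_pos hk, map_smul, hφk, smul_eq_mul, mul_one] at h1
    exact h1
  · have hev : ∀ n ≥ N, eLpNorm (fun ω => Y ω - ∑ k ∈ Finset.range n, X k ω) 2 P =
        eLpNorm (fun ω => Y ω - ∑ k ∈ Finset.range N, X k ω) 2 P := by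
      intro n hn
      refine eLpNorm_congr_ae ?_
      have h0 : ∀ᵐ ω ∂P, ∀ k, N ≤ k → X k ω = 0 := by
        rw [ae_all_iff]
        intro k
        by_cases hk : N ≤ k
        · filter_upwards [hX0 k hk] with ω hω _
          exact hω
        · exact ae_of_all _ fun ω h => absurd h hk
      filter_upwards [h0] with ω hω
      congr 1
      refine (Finset.sum_subset (Finset.range_mono hn) fun k _ hk => hω k ?_).symm
      exact not_lt.1 fun h => hk (Finset.mem_range.2 h)
    have hzero : eLpNorm (fun ω => Y ω - ∑ k ∈ Finset.range N, X k ω) 2 P = 0 := by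
      refine tendsto_nhds_unique (tendsto_const_nhds.congr' ?_) hlim
      filter_upwards [eventually_ge_atTop N] with n hn
      exact (hev n hn).symm
    have hsm : AEStronglyMeasurable (fun ω => Y ω - ∑ k ∈ Finset.range N, X k ω) P :=
      hY.memLp.aestronglyMeasurable.sub (Finset.aestronglyMeasurable_fun_sum _ fun k _ =>
        (hX k).memLp.aestronglyMeasurable)
    have hall : ∀ᵐ ω ∂P, ∀ k, X k ω = φ k (X k ω) • eigenfunction k := ae_all_iff.2 hXk
    filter_upwards [(eLpNorm_eq_zero_iff hsm two_ne_zero).1 hzero, hall] with ω h1 h2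
    rw [sub_eq_zero.1 h1]
    exact Finset.sum_congr rfl fun k _ => h2 k

/-- If `η` is large compared with `b`, the coordinates of the stochastic convolution have
exponential square moments of order `b`, uniformly in time. -/
theorem IsCylindricalFBM.lintegral_exp_sq_coordinate_le [IsProbabilityMeasure P]
    (hw : IsCylindricalFBM H T w P) (hH : 1 / 2 < H) (hH1 : H < 1) (hT : 0 < T) {N : ℕ}
    {b η t : ℝ} (hb : 0 ≤ b) (hη : 4 * (b + 1) * (2 * fbmKernelPrimitive H T + 1) ≤ η)
    (ht : t ∈ Set.Icc 0 T) {Y : Ω → U} (hY : HasCylindricalIntegral H P w t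
      (fun s => (galerkinSpace N).subtypeL ∘L galerkinSemigroup N η (t - s) ∘L galerkinProj N) Y)
    {j : ℕ} (hj : j < N) :
    ∫⁻ ω, ENNReal.ofReal (Real.exp (b * inner ℝ (eigenfunction j) (Y ω) ^ 2)) ∂P ≤ 2 := by
  obtain ⟨ξ, hξ, hYξ⟩ := hw.exists_coefficients hH ht.2 hY
  have h1 : ∀ᵐ ω ∂P, inner ℝ (eigenfunction j) (Y ω) = ξ j ω := by
    filter_upwards [hYξ] with ω hω
    rw [hω, inner_eigenfunction_sum hj]
  have h2 : ∫⁻ ω, ENNReal.ofReal (Real.exp (b * inner ℝ (eigenfunction j) (Y ω) ^ 2)) ∂P =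
      ∫⁻ ω, ENNReal.ofReal (Real.exp (b * ξ j ω ^ 2)) ∂P := by
    refine lintegral_congr_ae ?_
    filter_upwards [h1] with ω hω
    rw [hω]
  have hK : 0 ≤ fbmKernelPrimitive H T := fbmKernelPrimitive_nonneg hH hT.le
  have hη0 : 0 < η := lt_of_lt_of_le (by positivity) hη
  have hlam : 0 ≤ eigenvalue j := by
    unfold eigenvalue
    positivity
  rw [h2]
  -- The variance bound `1 / (4 (b + 1))` gives `b δ ≤ 1 / 4` for all `b ≥ 0`.
  refine (hw.isFBM j).lintegral_exp_sq_wienerIntegral_le hH hH1 hT ht.2 (hξ j hj) ?_ hb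
    (δ := 1 / (4 * (b + 1))) (by positivity) ?_ ?_
  · intro u hu
    rw [Real.enorm_of_nonneg (Real.exp_pos _).le, ← ENNReal.ofReal_one]
    refine ENNReal.ofReal_le_ofReal (Real.exp_le_one_iff.2 (neg_nonpos.2 ?_))
    exact mul_nonneg (by linarith [hu.2]) (by positivity)
  · rw [mul_one_div, div_le_div_iff₀ (by positivity) (by positivity)]
    linarith
  · refine (mul_le_mul_right (lintegral_exp_decay_le hη0 (le_add_of_nonneg_left hlam) ht.1)
      _).trans_lt ?_
    rw [← ENNReal.ofReal_mul (by positivity), ENNReal.ofReal_lt_ofReal_iff (by positivity),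
      mul_one_div, div_lt_div_iff₀ hη0 (by positivity), one_mul]
    refine lt_of_lt_of_le ?_ hη
    rw [mul_comm]
    exact mul_lt_mul_of_pos_left (lt_add_one _) (by positivity)

/-- Paths of the Ornstein–Uhlenbeck type integral `∫₀ᵗ exp(-(t-s)a) dw(s)`, given by integration by
parts, are continuous wherever those of `w` are. -/
theorem continuousOn_byParts_exp (hT : 0 ≤ T) (a : ℝ) {Ω' : Type*} {w : ℝ → Ω' → ℝ} {ω : Ω'}
    (hω : ContinuousOn (fun t => w t ω) (Set.Icc 0 T)) :
    ContinuousOn (fun t => byParts (fun s => Real.exp (-((t - s) * a)))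
      (fun s => a * Real.exp (-((t - s) * a))) w t ω) (Set.Icc 0 T) := by
  have h1 : ∀ t, byParts (fun s => Real.exp (-((t - s) * a)))
      (fun s => a * Real.exp (-((t - s) * a))) w t ω =
      w t ω - Real.exp (-(t * a)) * w 0 ω
        - a * Real.exp (-(t * a)) * ∫ s in (0 : ℝ)..t, Real.exp (s * a) * w s ω := by
    intro t
    rw [byParts, ← intervalIntegral.integral_const_mul, sub_self, zero_mul, neg_zero, Real.exp_zero,
      one_mul, sub_zero]
    congr 1
    refine intervalIntegral.integral_congr fun s _ => ?_
    have : Real.exp (-((t - s) * a)) = Real.exp (-(t * a)) * Real.exp (s * a) := by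
      rw [← Real.exp_add]
      ring_nf
    simp only [this]
    ring
  simp only [h1]
  have hI : ContinuousOn (fun t => ∫ s in (0 : ℝ)..t, Real.exp (s * a) * w s ω)
      (Set.Icc 0 T) := by
    rw [← Set.uIcc_of_le hT]
    refine intervalIntegral.continuousOn_primitive_interval ?_
    rw [Set.uIcc_of_le hT]
    exact ((by fun_prop : Continuous fun s : ℝ => Real.exp (s * a)).continuousOn.mul
      hω).integrableOn_compact isCompact_Icc
  exact (hω.sub ((by fun_prop : Continuous fun t : ℝ => Real.exp (-(t * a))).continuousOn.mul
    continuousOn_const)).sub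
    ((by fun_prop : Continuous fun t : ℝ => a * Real.exp (-(t * a))).continuousOn.mul hI)

theorem IsCylindricalFBM.exists_galerkinConvolution [IsProbabilityMeasure P]
    (hw : IsCylindricalFBM H T w P) (hH : 1 / 2 < H) (hT : 0 ≤ T) (N : ℕ) (η : ℝ) :
    ∃ O : ℝ → Ω → U, IsGalerkinConvolution H T P w N η O := by
  set ξ : ℕ → ℝ → Ω → ℝ := fun k t => byParts
    (fun s => Real.exp (-((t - s) * (eigenvalue k + η))))
    (fun s => (eigenvalue k + η) * Real.exp (-((t - s) * (eigenvalue k + η)))) (w k) t with hξ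
  have hint : ∀ k, ∀ t ∈ Set.Icc 0 T, HasWienerIntegral H P (w k) t
      (fun s => Real.exp (-((t - s) * (eigenvalue k + η)))) (ξ k t) := by
    intro k t ht
    exact (hw.isFBM k).hasWienerIntegral_byParts hH ht
      (hasDerivAt_exp_decay t (eigenvalue k + η)) (by fun_prop)
  have hvec : ∀ k, ∀ t ∈ Set.Icc 0 T, HasWienerIntegral H P (w k) t
      (fun s => (if k < N then Real.exp (-((t - s) * (eigenvalue k + η))) else 0) • eigenfunction k)
      (fun ω => (if k < N then ξ k t ω else 0) • eigenfunction k) := by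
    intro k t ht
    split_ifs with hk
    · exact (hint k t ht).map ((ContinuousLinearMap.id ℝ ℝ).smulRight (eigenfunction k))
    · simpa only [_root_.zero_apply, zero_smul] using
        (hint k t ht).map (0 : ℝ →L[ℝ] U)
  refine ⟨fun t ω => ∑ k ∈ Finset.range N, ξ k t ω • eigenfunction k, ?_, fun t ht => ⟨?_,
    fun k ω => (if k < N then ξ k t ω else 0) • eigenfunction k, fun k => ?_, ?_⟩⟩
  · refine Finset.aestronglyMeasurable_fun_sum _ fun k _ => ?_
    refine AEStronglyMeasurable.smul_const ?_ _
    exact aestronglyMeasurable_of_continuous_paths hT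
      (fun t ht => (hint k t ht).memLp.aestronglyMeasurable.aemeasurable)
      ((hw.isFBM k).continuous_paths.mono fun ω hω => continuousOn_byParts_exp hT _ hω)
  · exact memLp_finsetSum _ fun k _ =>
      ((ContinuousLinearMap.id ℝ ℝ).smulRight (eigenfunction k)).comp_memLp' (hint k t ht).memLp
  · simp only [galerkinIntegrand_eigenfunction]
    exact hvec k t ht
  · refine tendsto_const_nhds.congr' ?_
    filter_upwards [eventually_ge_atTop N] with n hn
    symm
    have : (fun ω => ∑ k ∈ Finset.range N, ξ k t ω • eigenfunction k -
        ∑ k ∈ Finset.range n, (if k < N then ξ k t ω else 0) • eigenfunction k) = 0 := by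
      funext ω
      refine sub_eq_zero.2 ?_
      rw [← Finset.sum_subset (Finset.range_mono hn)]
      · exact Finset.sum_congr rfl fun k hk => by rw [if_pos (Finset.mem_range.1 hk)]
      · intro k _ hk
        rw [if_neg fun h => hk (Finset.mem_range.2 h), zero_smul]
    rw [this, eLpNorm_zero]

end Convolution

/-! ### Exponential integrability -/

/-- Jensen's inequality for the exponential function, allowing infinite integrals. -/
theorem exp_lintegral_le {α : Type*} [MeasurableSpace α] {μ : Measure α} [IsProbabilityMeasure μ]
    {f : α → ℝ} (hf : AEMeasurable f μ) (h0 : ∀ x, 0 ≤ f x) :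
    EReal.exp ((∫⁻ x, ENNReal.ofReal (f x) ∂μ : ℝ≥0∞) : EReal) ≤
      ∫⁻ x, ENNReal.ofReal (Real.exp (f x)) ∂μ := by
  by_cases htop : ∫⁻ x, ENNReal.ofReal (Real.exp (f x)) ∂μ = ∞
  · rw [htop]
    exact le_top
  have hexp : Integrable (fun x => Real.exp (f x)) μ :=
    (lintegral_ofReal_ne_top_iff_integrable (by fun_prop)
      (ae_of_all _ fun x => (Real.exp_pos _).le)).1 htop
  have hint : Integrable f μ := by
    refine hexp.mono hf.aestronglyMeasurable (ae_of_all _ fun x => ?_)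
    rw [Real.norm_of_nonneg (h0 x), Real.norm_of_nonneg (Real.exp_pos _).le]
    linarith [Real.add_one_le_exp (f x)]
  rw [← ofReal_integral_eq_lintegral_ofReal hint (ae_of_all _ h0),
    ← ofReal_integral_eq_lintegral_ofReal hexp (ae_of_all _ fun x => (Real.exp_pos _).le),
    EReal.coe_ennreal_ofReal, max_eq_left (integral_nonneg h0), EReal.exp_coe]
  exact ENNReal.ofReal_le_ofReal (convexOn_exp.map_integral_le Real.continuous_exp.continuousOn
    isClosed_univ (ae_of_all _ fun _ => Set.mem_univ _) hint hexp)

/-- A pointwise bound on the exponential of a sum, which reduces its expectation to those of the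
single summands. -/
theorem exp_sum_range_le (N : ℕ) (a : ℕ → ℝ) :
    Real.exp (∑ j ∈ Finset.range N, a j) ≤ 1 + ∑ j ∈ Finset.range N, Real.exp (N * a j) := by
  rcases Nat.eq_zero_or_pos N with rfl | hN
  · simp
  obtain ⟨i, hi, hmax⟩ := Finset.exists_max_image (Finset.range N) a ⟨0, Finset.mem_range.2 hN⟩
  have h1 : ∑ j ∈ Finset.range N, a j ≤ N * a i := by
    have := Finset.sum_le_card_nsmul _ _ _ hmax
    rwa [Finset.card_range, nsmul_eq_mul] at this
  calc _ ≤ Real.exp (N * a i) := Real.exp_le_exp.2 h1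
    _ ≤ ∑ j ∈ Finset.range N, Real.exp (N * a j) :=
        Finset.single_le_sum (f := fun j => Real.exp (N * a j)) (fun j _ => (Real.exp_pos _).le) hi
    _ ≤ _ := le_add_of_nonneg_left zero_le_one

section Integrability

variable {Ω : Type*} [MeasurableSpace Ω] {P : Measure Ω} {H T : ℝ} {w : ℕ → ℝ → Ω → ℝ}

/-- Almost every path of the stochastic convolution takes values in the Galerkin space at almost
every time. -/
theorem IsGalerkinConvolution.ae_eq_sum [IsProbabilityMeasure P] (hw : IsCylindricalFBM H T w P)
    (hH : 1 / 2 < H) {N : ℕ} {η : ℝ} {O : ℝ → Ω → U} (hO : IsGalerkinConvolution H T P w N η O) :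
    ∀ᵐ ω ∂P, ∀ᵐ t ∂(volume.restrict (Set.Icc 0 T)),
      O t ω = ∑ j ∈ Finset.range N, (inner ℝ (eigenfunction j) (O t ω) : ℝ) • eigenfunction j := by
  set D : ℝ × Ω → ℝ≥0∞ := fun p => ‖O p.1 p.2 -
    ∑ j ∈ Finset.range N, (inner ℝ (eigenfunction j) (O p.1 p.2) : ℝ) • eigenfunction j‖ₑ with hD
  have hDm : AEMeasurable D ((volume.restrict (Set.Icc 0 T)).prod P) := by
    refine (hO.aestronglyMeasurable.sub (Finset.aestronglyMeasurable_fun_sum _ fun j _ => ?_)).enorm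
    exact ((innerSL ℝ (eigenfunction j)).continuous.comp_aestronglyMeasurable
      hO.aestronglyMeasurable).smul_const _
  have hslice : ∀ t ∈ Set.Icc 0 T, ∫⁻ ω, D (t, ω) ∂P = 0 := by
    intro t ht
    obtain ⟨ξ, -, hξ⟩ := hw.exists_coefficients hH ht.2 (hO.integral_eq t ht)
    refine lintegral_eq_zero_of_ae_eq_zero ?_
    filter_upwards [hξ] with ω hω
    have hc : ∀ j ∈ Finset.range N, inner ℝ (eigenfunction j) (O t ω) = ξ j ω := by
      intro j hj
      rw [hω, inner_eigenfunction_sum (Finset.mem_range.1 hj)]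
    have : O t ω - ∑ j ∈ Finset.range N,
        (inner ℝ (eigenfunction j) (O t ω) : ℝ) • eigenfunction j = 0 := by
      refine sub_eq_zero.2 (hω.trans (Finset.sum_congr rfl fun j hj => ?_))
      rw [hc j hj]
    simp only [hD, this, enorm_zero, Pi.zero_apply]
  have hzero : ∫⁻ p, D p ∂((volume.restrict (Set.Icc 0 T)).prod P) = 0 := by
    rw [lintegral_prod _ hDm, setLIntegral_congr_fun measurableSet_Icc hslice, lintegral_zero]
  have hae := (lintegral_eq_zero_iff' hDm).1 hzero
  have hswap : ∀ᵐ q : Ω × ℝ ∂(P.prod (volume.restrict (Set.Icc 0 T))), D q.swap = 0 :=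
    Measure.measurePreserving_swap.quasiMeasurePreserving.ae hae
  filter_upwards [Measure.ae_ae_of_ae_prod hswap] with ω hω
  filter_upwards [hω] with t ht
  exact sub_eq_zero.1 (enorm_eq_zero.1 ht)

/-- Uniform exponential moments of the values pass to the time integral, by Jensen's inequality
with respect to the normalised Lebesgue measure on `[0,T]` and Tonelli's theorem. -/
theorem lintegral_exp_time_integral_le [IsProbabilityMeasure P] (hT : 0 < T) {c : ℝ} (hc : 0 ≤ c)
    {f : ℝ → Ω → ℝ} (hf : AEStronglyMeasurable (fun p : ℝ × Ω => f p.1 p.2)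
      ((volume.restrict (Set.Icc 0 T)).prod P)) (h0 : ∀ t ω, 0 ≤ f t ω) {C : ℝ≥0∞}
    (hC : ∀ t ∈ Set.Icc 0 T, ∫⁻ ω, ENNReal.ofReal (Real.exp (c * T * f t ω)) ∂P ≤ C) :
    ∫⁻ ω, EReal.exp ((ENNReal.ofReal c * ∫⁻ t in Set.Icc 0 T, ENNReal.ofReal (f t ω) : ℝ≥0∞) :
      EReal) ∂P ≤ C := by
  set μ : Measure ℝ := (ENNReal.ofReal T)⁻¹ • volume.restrict (Set.Icc 0 T) with hμ
  have hT0 : ENNReal.ofReal T ≠ 0 := (ENNReal.ofReal_pos.2 hT).ne'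
  have hμp : IsProbabilityMeasure μ := ⟨by
    rw [hμ, Measure.smul_apply, Measure.restrict_apply_univ, Real.volume_Icc, sub_zero,
      smul_eq_mul, ENNReal.inv_mul_cancel hT0 ENNReal.ofReal_ne_top]⟩
  have hac : μ ≪ volume.restrict (Set.Icc 0 T) := Measure.smul_absolutelyContinuous
  have hfμ : AEStronglyMeasurable (fun p : ℝ × Ω => f p.1 p.2) (μ.prod P) :=
    hf.mono_ac (hac.prod Measure.AbsolutelyContinuous.rfl)
  have hsec : ∀ᵐ ω ∂P, AEStronglyMeasurable (fun t => f t ω) μ := hfμ.prod_swap.prodMk_left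
  have hrescale : ∀ ω, ENNReal.ofReal c * ∫⁻ t in Set.Icc 0 T, ENNReal.ofReal (f t ω) =
      ∫⁻ t, ENNReal.ofReal (c * T * f t ω) ∂μ := by
    intro ω
    simp only [ENNReal.ofReal_mul (mul_nonneg hc hT.le)]
    rw [lintegral_const_mul' _ _ ENNReal.ofReal_ne_top, hμ, lintegral_smul_measure, smul_eq_mul,
      ENNReal.ofReal_mul hc, mul_assoc, ← mul_assoc (ENNReal.ofReal T),
      ENNReal.mul_inv_cancel hT0 ENNReal.ofReal_ne_top, one_mul]
  calc _ ≤ ∫⁻ ω, (∫⁻ t, ENNReal.ofReal (Real.exp (c * T * f t ω)) ∂μ) ∂P := by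
        refine lintegral_mono_ae ?_
        filter_upwards [hsec] with ω hω
        rw [hrescale]
        exact exp_lintegral_le (hω.aemeasurable.const_mul _)
          fun t => mul_nonneg (mul_nonneg hc hT.le) (h0 t ω)
    _ = ∫⁻ t, (∫⁻ ω, ENNReal.ofReal (Real.exp (c * T * f t ω)) ∂P) ∂μ := by
        rw [lintegral_lintegral_swap (f := fun ω t => ENNReal.ofReal (Real.exp (c * T * f t ω)))]
        exact (Real.measurable_exp.comp_aemeasurable
          (hfμ.prod_swap.aemeasurable.const_mul (c * T))).ennreal_ofReal
    _ ≤ ∫⁻ _, C ∂μ := lintegral_mono_ae (hac.ae_le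
        ((ae_restrict_mem measurableSet_Icc).mono hC))
    _ = C := by rw [lintegral_const, measure_univ, mul_one]

end Integrability

end BurgersFBM

theorem mainTheorem4 {Ω : Type*} [MeasurableSpace Ω] (P : Measure Ω) [IsProbabilityMeasure P]
    (H T : ℝ) (hH : 1 / 2 < H) (hH1 : H < 1) (hT : 0 < T)
    (w : ℕ → ℝ → Ω → ℝ) (hw : BurgersFBM.IsCylindricalFBM H T w P)
    (c : ℝ) (hc : 0 < c) (N : ℕ) :
    ∃ η : ℝ, 0 ≤ η ∧
      (∃ O : ℝ → Ω → BurgersFBM.U, BurgersFBM.IsGalerkinConvolution H T P w N η O) ∧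
      ∀ O : ℝ → Ω → BurgersFBM.U, BurgersFBM.IsGalerkinConvolution H T P w N η O →
        ∫⁻ ω, EReal.exp ((ENNReal.ofReal c *
          ∫⁻ t in Set.Icc 0 T, (eLpNorm (O t ω : ℝ → ℝ) ∞ BurgersFBM.leb01 ^ 2 + 1) : ℝ≥0∞) :
            EReal) ∂P < ∞ := by
  open BurgersFBM in
  -- The factor of the squared coordinates in the exponent: `c * T` from Jensen's inequality in time,
  -- `2 * N` from the supremum norm, and another `N` from splitting the sum of `N` coordinates.
  set b : ℝ := N * (c * T * (2 * N)) with hb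
  have hb0 : 0 ≤ b := by positivity
  have hK : 0 ≤ fbmKernelPrimitive H T := fbmKernelPrimitive_nonneg hH hT.le
  refine ⟨4 * (b + 1) * (2 * fbmKernelPrimitive H T + 1), by positivity,
    hw.exists_galerkinConvolution hH hT.le N _, fun O hO => ?_⟩
  set Z : ℕ → ℝ → Ω → ℝ := fun j t ω => inner ℝ (eigenfunction j) (O t ω) with hZ
  have hZm : ∀ j, AEStronglyMeasurable (fun p : ℝ × Ω => Z j p.1 p.2)
      ((volume.restrict (Set.Icc 0 T)).prod P) := fun j =>
    (innerSL ℝ (eigenfunction j)).continuous.comp_aestronglyMeasurable hO.aestronglyMeasurable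
  set f : ℝ → Ω → ℝ := fun t ω => 2 * N * ∑ j ∈ Finset.range N, Z j t ω ^ 2 + 1 with hf
  have hf0 : ∀ t ω, 0 ≤ f t ω := fun t ω => by positivity
  have hfm : AEStronglyMeasurable (fun p : ℝ × Ω => f p.1 p.2)
      ((volume.restrict (Set.Icc 0 T)).prod P) :=
    ((Finset.aestronglyMeasurable_fun_sum _ fun j _ => (hZm j).pow 2).const_mul _).add
      aestronglyMeasurable_const
  have hbound : ∀ t ∈ Set.Icc 0 T, ∫⁻ ω, ENNReal.ofReal (Real.exp (c * T * f t ω)) ∂P ≤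
      ENNReal.ofReal (Real.exp (c * T)) * (1 + N * 2) := by
    intro t ht
    have hmem := (hO.integral_eq t ht).memLp.aestronglyMeasurable
    have hZt : ∀ j, AEMeasurable (Z j t) P := fun j =>
      ((innerSL ℝ (eigenfunction j)).continuous.comp_aestronglyMeasurable hmem).aemeasurable
    have hpt : ∀ ω, ENNReal.ofReal (Real.exp (c * T * f t ω)) ≤
        ENNReal.ofReal (Real.exp (c * T)) *
          (1 + ∑ j ∈ Finset.range N, ENNReal.ofReal (Real.exp (b * Z j t ω ^ 2))) := by
      intro ω
      rw [← ENNReal.ofReal_sum_of_nonneg fun j _ => (Real.exp_pos _).le, ← ENNReal.ofReal_one,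
        ← ENNReal.ofReal_add zero_le_one (Finset.sum_nonneg fun j _ => (Real.exp_pos _).le),
        ← ENNReal.ofReal_mul (Real.exp_pos _).le]
      refine ENNReal.ofReal_le_ofReal ?_
      have h1 : c * T * f t ω =
          c * T + ∑ j ∈ Finset.range N, c * T * (2 * N) * Z j t ω ^ 2 := by
        rw [hf, ← Finset.mul_sum]
        ring
      rw [h1, Real.exp_add]
      refine mul_le_mul_of_nonneg_left ((exp_sum_range_le N _).trans_eq ?_) (Real.exp_pos _).le
      simp only [hb, mul_assoc]
    calc _ ≤ ∫⁻ ω, ENNReal.ofReal (Real.exp (c * T)) *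
          (1 + ∑ j ∈ Finset.range N, ENNReal.ofReal (Real.exp (b * Z j t ω ^ 2))) ∂P :=
          lintegral_mono hpt
      _ = ENNReal.ofReal (Real.exp (c * T)) * (1 + ∑ j ∈ Finset.range N,
            ∫⁻ ω, ENNReal.ofReal (Real.exp (b * Z j t ω ^ 2)) ∂P) := by
          rw [lintegral_const_mul' _ _ ENNReal.ofReal_ne_top, lintegral_add_left measurable_const,
            lintegral_one, measure_univ, lintegral_finsetSum']
          intro j _
          have := hZt j
          fun_prop
      _ ≤ ENNReal.ofReal (Real.exp (c * T)) * (1 + ∑ j ∈ Finset.range N, 2) := by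
          gcongr with j hj
          exact hw.lintegral_exp_sq_coordinate_le hH hH1 hT hb0 le_rfl ht (hO.integral_eq t ht)
            (Finset.mem_range.1 hj)
      _ = _ := by simp
  refine lt_of_le_of_lt ?_ ((lintegral_exp_time_integral_le hT hc.le hfm hf0 hbound).trans_lt
    (by finiteness))
  refine lintegral_mono_ae ?_
  filter_upwards [hO.ae_eq_sum hw hH] with ω hω
  refine EReal.exp_monotone (EReal.coe_ennreal_le_coe_ennreal_iff.2 ?_)
  refine mul_le_mul_right (lintegral_mono_ae ?_) _
  filter_upwards [hω] with t ht
  rw [hf, ENNReal.ofReal_add (by positivity) zero_le_one, ENNReal.ofReal_one]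
  refine add_le_add ?_ le_rfl
  rw [ht]
  exact eLpNorm_top_sq_le _ N
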